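/- Let $\Delta=\{z\in\mathbb C:|z|\le 1\}$, $\mathbb D$ its interior, $\mathbb T$ its boundary, $|dz|$ arc length on $\mathbb T$ (total mass $2\pi$), $dA$ area measure. Let $A(\mathbb D)$ be the disc algebra (continuous functions on $\Delta$, holomorphic on $\mathbb D$, with the supremum norm). A derivation is a bounded linear map $D:A(\mathbb D)\to A(\mathbb D)^*$ with $D(ab)(c)=D(b)(ca)+D(a)(cb)$. For $1\le p<\infty$, $H^p$ is the space of $f\in L^p(\mathbb T)$ whose negative Fourier coefficients vanish, identified with the holomorphic functions $f(z)=\sum_{n\ge0}\widehat f(n)z^n$ on $\mathbb D$, and $H^p_0=\{f\in H^p:\int_{\mathbb T} f\,|dz|=0\}$. For $h\in H^1_0$ and polynomials $f,g$ put $D_h(f)(g)=\int_{\mathbb T}u\,\overline h\,|dz|$, where $u$ is the polynomial with $u'=f'g$, $u(0)=0$; write $\|D_h(f)\|$ for the least $C$ such that $|D_h(f)(g)|\le C\|g\|_\infty$ for all polynomials $g$. A derivation $D$ is said to equal $D_h$ if $D(f)(g)=D_h(f)(g)$ for all polynomials $f,g$. For $k\in H^2_0$ define positive Borel measures on $\Delta$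 by $$\mu_B^k(X)=\int_{X\cap\mathbb T}|k|^2\,|dz|,\qquad \mu_I^k(X)=\int_{X\cap\mathbb D}|k'(z)|^2\,4\log\frac1{|z|}\,dA(z),$$ and let $\lambda(X)=\int_{X\cap\mathbb T}|dz|$. Then the following hold. 1. Every derivation $D:A(\mathbb D)\to A(\mathbb D)^*$ equals $D_h$ for some $h\in H^1_0$. 2. Every $h\in H^1_0$ can be written $h=\alpha z+k_1^2+k_2^2$ with $\alpha\in\mathbb C$ and $k_1,k_2\in H^2_0$. 3. ($\spadesuit$) For every $k\in H^2_0$ the measures $\mu=16\|k\|_2^2\,\mu_B^k$ and $\nu=16\|k\|_2^2\,\mu_I^k$ are finite, where $\|k\|_2^2=\int_{\mathbb T}|k|^2|dz|$, and $\|D_{k^2}(f)\|\le\|f\|_{L^2(\mu)}+\|f\|_{L^2(\nu)}$ for all polynomials $f$. 4. Let $h\in H^1_0$ and let $h=\alpha z+k_1^2+k_2^2$ be any decomposition as in 2. Put $$\mu_1=2\pi|\alpha|^2\lambda,\quad \mu_2=16\|k_1\|_2^2\,\mu_B^{k_1},\quad \mu_3=16\|k_1\|_2^2\,\mu_I^{k_1},\quad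 \mu_4=16\|k_2\|_2^2\,\mu_B^{k_2},\quad \mu_5=16\|k_2\|_2^2\,\mu_I^{k_2}.$$ These measures are finite and $\|D_h(f)\|\le\sum_{j=1}^5\|f\|_{L^2(\mu_j)}$ for all polynomials $f$. 5. ($\star$) If moreover $D$ is a derivation that equals $D_h$, then $\mu_D=\sqrt5\,(\mu_1+\dots+\mu_5)$ is a finite positive Borel measure on $\Delta$ with $$\|D(f)\|\le\Big(\int_\Delta|f|^2\,d\mu_D\Big)^{1/2}\qquad\text{for all } f\in A(\mathbb D).$$ Consequently $D$ is 2-summing: there is $C$ such that for all finite families $x_1,\dots,x_n\in A(\mathbb D)$, $\big(\sum_i\|D(x_i)\|^2\big)^{1/2}\le C\sup_{\|\varphi\|\le1}\big(\sum_i|\varphi(x_i)|^2\big)^{1/2}$, the supremum being over $\varphi\in A(\mathbb D)^*$. Also, $D$ factors through $L^2(\mu_D)$: there is a bounded linear $T:L^2(\mu_D)\to A(\mathbb D)^*$, $\|T\|\le1$, with $D(f)=T([f])$ for all $f\in A(\mathbb D)$. -/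

import Mathlib

open Polynomial MeasureTheory
open scoped Real ENNReal ComplexConjugate

noncomputable section

namespace DiscPietsch

instance factTwoPiPos : Fact (0 < 2 * π) := ⟨Real.two_pi_pos⟩

/-! ### The closed disc, the circle and the disc algebra -/

/-- The closed unit disc, as a compact metric space. -/
abbrev Disc : Type := Metric.closedBall (0 : ℂ) 1

/-- The unit circle, parametrised by the angle `θ ↦ exp (i θ)`.  Its `volume` is arc length,
with total mass `2 π`. -/
abbrev Torus : Type := AddCircle (2 * π)

/-- The point `exp (i θ)` of the boundary of the closed disc. -/
def boundaryPoint (θ : Torus) : Disc := ⟨(AddCircle.toCircle θ : ℂ), by simp [Circle.norm_coe]⟩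

/-- The extension by zero to the plane of a function on the closed disc. -/
def extendByZero (f : Disc → ℂ) : ℂ → ℂ := Function.extend Subtype.val f 0

theorem extendByZero_of_mem (f : Disc → ℂ) {z : ℂ} (hz : z ∈ Metric.closedBall (0 : ℂ) 1) :
    extendByZero f z = f ⟨z, hz⟩ :=
  Subtype.val_injective.extend_apply f 0 ⟨z, hz⟩

theorem extendByZero_eqOn {f : Disc → ℂ} {F : ℂ → ℂ} (h : ∀ z : Disc, F z = f z) :
    Set.EqOn (extendByZero f) F (Metric.ball 0 1) := fun z hz => by
  rw [extendByZero_of_mem f (Metric.ball_subset_closedBall hz)]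
  exact (h ⟨z, _⟩).symm

/-- The disc algebra: continuous functions on the closed disc, holomorphic in its interior,
with the supremum norm. -/
def discAlgebra : Subalgebra ℂ C(Disc, ℂ) where
  carrier := {f | DifferentiableOn ℂ (extendByZero f) (Metric.ball 0 1)}
  mul_mem' {f g} hf hg := (DifferentiableOn.mul hf hg).congr fun z hz => by
    simp [extendByZero_of_mem _ (Metric.ball_subset_closedBall hz)]
  add_mem' {f g} hf hg := (DifferentiableOn.add hf hg).congr fun z hz => by
    simp [extendByZero_of_mem _ (Metric.ball_subset_closedBall hz)]
  algebraMap_mem' c := (differentiableOn_const (c := c)).congr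
    (extendByZero_eqOn fun _ => rfl)

/-- The disc algebra as a type, a commutative normed algebra with the supremum norm. -/
def DiscAlg : Type := discAlgebra

instance : NormedCommRing DiscAlg := inferInstanceAs (NormedCommRing discAlgebra)

instance : NormedAlgebra ℂ DiscAlg := inferInstanceAs (NormedAlgebra ℂ discAlgebra)

/-- The inclusion of the disc algebra in the continuous functions on the closed disc. -/
def DiscAlg.incl : DiscAlg →ₐ[ℂ] C(Disc, ℂ) := discAlgebra.val

theorem DiscAlg.norm_incl (f : DiscAlg) : ‖f.incl‖ = ‖f‖ := rfl

/-- The coordinate function `z ↦ z`, as an element of the disc algebra. -/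
def coord : DiscAlg :=
  ⟨⟨Subtype.val, continuous_subtype_val⟩, differentiableOn_id.congr (extendByZero_eqOn fun _ => rfl)⟩

/-- An analytic polynomial, regarded as an element of the disc algebra. -/
def ofPoly (p : ℂ[X]) : DiscAlg := aeval coord p

theorem ofPoly_apply (p : ℂ[X]) (z : Disc) : (ofPoly p).incl z = p.eval (z : ℂ) := by
  have h : (ofPoly p).incl = aeval coord.incl p := (aeval_algHom_apply DiscAlg.incl coord p).symm
  have hz : ∀ q : ℂ[X], (aeval coord.incl q : C(Disc, ℂ)) z = q.eval (z : ℂ) := fun q => by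
    induction q using Polynomial.induction_on' with
    | add p q hp hq => simp_all
    | monomial n a =>
      simp [aeval_monomial, Algebra.algebraMap_eq_smul_one]
      exact Or.inl rfl
  rw [h, hz]

/-- A bounded linear map `D` from the disc algebra `A` to its dual is a derivation if
`D (a b) = a · D b + b · D a`, where `(a · φ) c = φ (c a)`. -/
def IsDerivation (D : DiscAlg →L[ℂ] StrongDual ℂ DiscAlg) : Prop :=
  ∀ a b c : DiscAlg, D (a * b) c = D b (c * a) + D a (c * b)

/-! ### Hardy spaces on the circle -/

/-- `f` represents an element of `H^p`: it lies in `L^p` of the circle and its negative Fourier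
coefficients vanish. -/
def MemHardy (p : ℝ≥0∞) (f : Torus → ℂ) : Prop :=
  MemLp f p volume ∧ ∀ n : ℤ, n < 0 → fourierCoeff f n = 0

/-- `f` represents an element of `H^p_0`: moreover its mean, the value at the origin of its
holomorphic extension, vanishes. -/
def MemHardyZero (p : ℝ≥0∞) (f : Torus → ℂ) : Prop :=
  MemHardy p f ∧ ∫ θ, f θ = 0

/-- The holomorphic extension of a Hardy space function to the open disc, given by its Taylor
series `∑ n ≥ 0, f̂(n) z ^ n`. -/
def hardyExt (f : Torus → ℂ) (z : ℂ) : ℂ := ∑' n : ℕ, fourierCoeff f (n : ℤ) * z ^ n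

/-! ### The derivation with symbol `h` -/

/-- The primitive of a polynomial that vanishes at the origin. -/
def primitive (p : ℂ[X]) : ℂ[X] := p.sum fun n a => monomial (n + 1) (a / (n + 1))

theorem derivative_primitive (p : ℂ[X]) : derivative (primitive p) = p := by
  conv_rhs => rw [← p.sum_monomial_eq]
  simp only [primitive, Polynomial.sum, derivative_sum, derivative_monomial]
  refine Finset.sum_congr rfl fun n _ => ?_
  have : (n : ℂ) + 1 ≠ 0 := Nat.cast_add_one_ne_zero n
  simp [div_mul_cancel₀ _ this]

theorem eval_zero_primitive (p : ℂ[X]) : (primitive p).eval 0 = 0 := by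
  simp [primitive, Polynomial.sum, eval_finsetSum]

/-- The bilinear form `D_h (f) (g) = ∫ u conj(h)` on polynomials, where `u' = f' g` and
`u (0) = 0`. -/
def derivForm (h : Torus → ℂ) (f g : ℂ[X]) : ℂ :=
  ∫ θ : Torus, (primitive (derivative f * g)).eval (AddCircle.toCircle θ : ℂ) * conj (h θ)

/-- `D = D_h`: the map `D` agrees with `D_h` on polynomials. -/
def HasSymbol (D : DiscAlg →L[ℂ] StrongDual ℂ DiscAlg) (h : Torus → ℂ) : Prop :=
  ∀ f g : ℂ[X], D (ofPoly f) (ofPoly g) = derivForm h f g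

/-! ### The measures -/

/-- Arc length on the circle, as a Borel measure on the closed disc. -/
def arcMeasure : Measure Disc := (volume : Measure Torus).map boundaryPoint

/-- The measure `4 log (1 / |z|) dA (z)` on the punctured open disc, as a Borel measure on the
closed disc. -/
def logMeasure : Measure Disc :=
  (((volume : Measure ℂ).comap (Subtype.val : Disc → ℂ)).restrict
    {z | 0 < ‖(z : ℂ)‖ ∧ ‖(z : ℂ)‖ < 1}).withDensity
      fun z => ENNReal.ofReal (4 * Real.log (1 / ‖(z : ℂ)‖))

/-- `μ_B`: the measure `|k|² |dz|` on the circle. -/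
def boundaryMeasure (k : Torus → ℂ) : Measure Disc :=
  ((volume : Measure Torus).withDensity fun θ => ENNReal.ofReal (‖k θ‖ ^ 2)).map boundaryPoint

/-- `μ_I`: the measure `|k'(z)|² 4 log (1 / |z|) dA (z)` in the interior of the disc. -/
def interiorMeasure (k : Torus → ℂ) : Measure Disc :=
  logMeasure.withDensity fun z => ENNReal.ofReal (‖deriv (hardyExt k) (z : ℂ)‖ ^ 2)

/-- The rescaling factor `(4 ‖k‖₂)²`. -/
def scale (k : Torus → ℂ) : ℝ≥0∞ := ENNReal.ofReal (16 * ∫ θ : Torus, ‖k θ‖ ^ 2)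

/-- The five measures attached to the decomposition `h = α z + k₁² + k₂²`. -/
def pieces (α : ℂ) (k₁ k₂ : Torus → ℂ) : Fin 5 → Measure Disc :=
  ![ENNReal.ofReal (2 * π * ‖α‖ ^ 2) • arcMeasure,
    scale k₁ • boundaryMeasure k₁, scale k₁ • interiorMeasure k₁,
    scale k₂ • boundaryMeasure k₂, scale k₂ • interiorMeasure k₂]

/-- The control measure `√5 (μ₁ + ⋯ + μ₅)`. -/
def pietschMeasure (α : ℂ) (k₁ k₂ : Torus → ℂ) : Measure Disc :=
  ENNReal.ofReal (√5) • ∑ j, pieces α k₁ k₂ j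

/-- The `L²(μ)` norm of an element of the disc algebra. -/
def l2Norm (μ : Measure Disc) (f : DiscAlg) : ℝ :=
  √(∫ z, ‖f.incl z‖ ^ 2 ∂μ)

/-- `h = α z + k₁² + k₂²` almost everywhere on the circle, with `k₁` and `k₂` in `H²_0`. -/
structure IsDecomposition (h : Torus → ℂ) (α : ℂ) (k₁ k₂ : Torus → ℂ) : Prop where
  left : MemHardyZero 2 k₁
  right : MemHardyZero 2 k₂
  eq : ∀ᵐ θ : Torus, h θ = α * (AddCircle.toCircle θ : ℂ) + k₁ θ ^ 2 + k₂ θ ^ 2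

/-! ### 2-summing operators and factorization -/

/-- `T` is `2`-summing: there is a constant `C` such that for every finite family `x`,
`(∑ ‖T xᵢ‖²)^(1/2) ≤ C sup_{‖φ‖ ≤ 1} (∑ |φ xᵢ|²)^(1/2)`. -/
def IsTwoSumming {E F : Type*} [NormedAddCommGroup E] [NormedSpace ℂ E]
    [NormedAddCommGroup F] [NormedSpace ℂ F] (T : E →L[ℂ] F) : Prop :=
  ∃ C : ℝ, ∀ (n : ℕ) (x : Fin n → E),
    √(∑ i, ‖T (x i)‖ ^ 2) ≤
      C * ⨆ φ : Metric.closedBall (0 : StrongDual ℂ E) 1, √(∑ i, ‖φ.1 (x i)‖ ^ 2)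

/-- `D` factors through `L²(μ)`: it is the canonical map `A → L²(μ)` followed by a bounded linear
map `L²(μ) → A*`, which can be taken of norm at most one. -/
def FactorsThroughL2 (D : DiscAlg →L[ℂ] StrongDual ℂ DiscAlg) (μ : Measure Disc) : Prop :=
  ∃ T : Lp ℂ 2 μ →L[ℂ] StrongDual ℂ DiscAlg, ‖T‖ ≤ 1 ∧
    ∀ f : DiscAlg, ∃ hf : MemLp f.incl 2 μ, D f = T (hf.toLp _)

end DiscPietsch

end

namespace DiscPietsch

open Filter Topology AddCircle

/-! ### The disc algebra -/

/-! Existence of the symbol. For polynomials `D f g = D u 1` with `u' = f' g`, so only the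
functional `ψ p = D p 1` matters. As `D f 1 = D (e^f) (e^{-f})`, this functional is controlled by
the real part of `f` on the circle alone (`IsDerivation.norm_apply_one_le`). A real `s` with `|s| ≤
1` has Fejér means of modulus at most one, whose analytic parts have bounded real part, so the
numbers `c m = conj (ψ (X ^ m)) / 2π` pair boundedly with the Fejér means of every such `s`. By
duality the Cesàro means of `∑ c m z ^ m` are bounded in `L¹`. Each of these polynomials factors as
`A B` in the disc algebra with `|A| = |B|` on the circle, so `A` and `B` stay bounded in `H²`.
Limits of their coefficients along an ultrafilter give `a, b ∈ H²` such that `a b` has coefficients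
`c` (`exists_mul_of_cesaro_bound`). The symbol thus appears at once as a function in `H¹`, with no
intermediate measure on the circle.

The decomposition. The same lemma, fed with the coefficients of `q ∈ H¹`, gives `q = a b`; the
polarisation `4 a b = (a + b)² - (a - b)²` turns the product into a sum of two squares.

The estimate. The Littlewood–Paley identity (`integral_mul_conj_eq`) turns `∫ u conj (k²)` into the
integral of `f' g conj (2 k k')` against `4 log (1 / |z|) dA`. By Cauchy–Schwarz this is at most `2
‖g‖ ‖f' k‖ ‖k'‖`. The same identity gives `‖k'‖ = ‖k‖` on the circle, and `f' k = (f k)' - f k'`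
gives `‖f' k‖ ≤ ‖f k‖ + ‖f k'‖`: a boundary term and an interior term. This is done for polynomial
`k` (`norm_derivForm_sq_eval_le`) and carried over to `H²_0` by Taylor polynomials.

The constant. The estimate carries the factor 2, while the measures are scaled for the factor 4. The
spare half is what allows the five terms to be merged with the constant `√5`, where plain
Cauchy–Schwarz would cost 5. Density of polynomials extends the bound to the disc algebra, and
domination by an `L²` norm yields 2-summability and the factorization. -/

theorem Disc.norm_le_one (z : Disc) : ‖(z : ℂ)‖ ≤ 1 := mem_closedBall_zero_iff.1 z.2

/-- The element of the disc algebra given by a function on the plane. -/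
noncomputable def DiscAlg.ofFun (F : ℂ → ℂ) (hc : ContinuousOn F (Metric.closedBall 0 1))
    (hd : DifferentiableOn ℂ F (Metric.ball 0 1)) : DiscAlg :=
  ⟨⟨fun z => F z, hc.domRestrict⟩, hd.congr (extendByZero_eqOn fun _ => rfl)⟩

theorem DiscAlg.ofFun_apply {F : ℂ → ℂ} (hc : ContinuousOn F (Metric.closedBall 0 1))
    (hd : DifferentiableOn ℂ F (Metric.ball 0 1)) (z : Disc) :
    (DiscAlg.ofFun F hc hd).incl z = F z := rfl

theorem DiscAlg.ext {f g : DiscAlg} (h : ∀ z, f.incl z = g.incl z) : f = g :=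
  Subtype.ext (ContinuousMap.ext h)

theorem DiscAlg.algebraMap_apply (c : ℂ) (z : Disc) : (algebraMap ℂ DiscAlg c).incl z = c := rfl

theorem DiscAlg.norm_le {f : DiscAlg} {C : ℝ} (hC : 0 ≤ C) :
    ‖f‖ ≤ C ↔ ∀ z, ‖f.incl z‖ ≤ C := by
  rw [← DiscAlg.norm_incl, ContinuousMap.norm_le _ hC]

theorem DiscAlg.norm_apply_le (f : DiscAlg) (z : Disc) : ‖f.incl z‖ ≤ ‖f‖ := by
  rw [← DiscAlg.norm_incl]; exact f.incl.norm_coe_le_norm z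

theorem ofPoly_add (p q : ℂ[X]) : ofPoly (p + q) = ofPoly p + ofPoly q := map_add _ _ _

theorem ofPoly_mul (p q : ℂ[X]) : ofPoly (p * q) = ofPoly p * ofPoly q := map_mul _ _ _

theorem ofPoly_one : ofPoly 1 = 1 := map_one _

theorem DiscAlg.extendByZero_apply (f : DiscAlg) (z : Disc) :
    extendByZero f.incl z = f.incl z := extendByZero_of_mem _ z.2

theorem DiscAlg.continuousOn_extendByZero (f : DiscAlg) :
    ContinuousOn (extendByZero f.incl) (Metric.closedBall 0 1) := by
  rw [continuousOn_iff_continuous_domRestrict]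
  convert f.incl.continuous using 1
  ext z
  exact f.extendByZero_apply z

theorem DiscAlg.differentiableOn_extendByZero (f : DiscAlg) :
    DifferentiableOn ℂ (extendByZero f.incl) (Metric.ball 0 1) := f.2

/-- Polynomials are dense in the disc algebra. -/
theorem exists_norm_sub_ofPoly_le (f : DiscAlg) {ε : ℝ} (hε : 0 < ε) :
    ∃ p : ℂ[X], ‖f - ofPoly p‖ ≤ ε := by
  have huc : UniformContinuous f.incl := CompactSpace.uniformContinuous_of_continuous f.incl.continuous
  obtain ⟨δ, hδ, hfδ⟩ := Metric.uniformContinuous_iff.1 huc (ε / 2) (by positivity)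
  -- The dilation `f (r z)` is within `ε / 2` of `f`, because `1 - r < δ`. With `r < s < t < 1`, the
  -- Cauchy series of radius `t` converges uniformly on radius `s`, which contains every `r z`; a
  -- truncation of it is the polynomial.
  obtain ⟨r, hr1, hr2⟩ : ∃ r : ℝ, max 0 (1 - δ) < r ∧ r < 1 := exists_between (by simp [hδ])
  have hr0 : 0 < r := (le_max_left _ _).trans_lt hr1
  have hrδ : 1 - δ < r := (le_max_right _ _).trans_lt hr1
  obtain ⟨s, hs1, hs2⟩ := exists_between hr2
  obtain ⟨t, ht1, ht2⟩ := exists_between hs2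
  set F := extendByZero f.incl
  lift s to NNReal using (hr0.trans hs1).le
  lift t to NNReal using (hr0.trans (hs1.trans ht1)).le
  have hF : HasFPowerSeriesOnBall F (cauchyPowerSeries F 0 t) 0 t :=
    (f.differentiableOn_extendByZero.mono
      (Metric.closedBall_subset_ball ht2)).hasFPowerSeriesOnBall
      (by exact_mod_cast (hr0.trans (hs1.trans ht1)))
  have hu := hF.tendstoUniformlyOn (r' := s) (by exact_mod_cast ht1)
  obtain ⟨n, hn⟩ := (Metric.tendstoUniformlyOn_iff.1 hu (ε / 2) (by positivity)).exists
  set P := cauchyPowerSeries F 0 t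
  refine ⟨∑ k ∈ Finset.range n, monomial k (P.coeff k * r ^ k), ?_⟩
  rw [DiscAlg.norm_le hε.le]
  intro z
  have hz := Disc.norm_le_one z
  have hrz : ‖(r : ℂ) * z‖ ≤ r := by
    rw [norm_mul, Complex.norm_real, Real.norm_of_nonneg hr0.le]
    exact mul_le_of_le_one_right hr0.le hz
  have hmem : (r : ℂ) * z ∈ Metric.closedBall (0 : ℂ) 1 := by
    simpa using hrz.trans hr2.le
  have h1 : ‖f.incl z - F (r * z)‖ ≤ ε / 2 := by
    rw [show F (r * z) = f.incl ⟨_, hmem⟩ from f.extendByZero_apply ⟨_, hmem⟩, ← dist_eq_norm]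
    refine (hfδ ?_).le
    rw [Subtype.dist_eq, dist_eq_norm]
    calc ‖(z : ℂ) - r * z‖ = ‖(1 - r : ℝ) * (z : ℂ)‖ := by push_cast; ring_nf
      _ = (1 - r) * ‖(z : ℂ)‖ := by
        rw [norm_mul, Complex.norm_real, Real.norm_of_nonneg (by linarith)]
      _ ≤ 1 - r := mul_le_of_le_one_right (by linarith) hz
      _ < δ := by linarith
  have h2 := hn (r * z) (by simpa using hrz.trans_lt hs1)
  rw [dist_eq_norm, zero_add] at h2
  have h3 : P.partialSum n (r * z) =
      (ofPoly (∑ k ∈ Finset.range n, monomial k (P.coeff k * r ^ k))).incl z := by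
    rw [ofPoly_apply, eval_finsetSum, FormalMultilinearSeries.partialSum]
    refine Finset.sum_congr rfl fun k _ => ?_
    rw [FormalMultilinearSeries.apply_eq_pow_smul_coeff, eval_monomial, smul_eq_mul]
    ring
  rw [h3] at h2
  rw [map_sub, ContinuousMap.sub_apply]
  calc _ ≤ ‖f.incl z - F (r * z)‖ + ‖F (r * z) - (ofPoly _).incl z‖ :=
        norm_sub_le_norm_sub_add_norm_sub _ _ _
    _ ≤ ε / 2 + ε / 2 := add_le_add h1 h2.le
    _ = ε := by ring

theorem denseRange_ofPoly : DenseRange ofPoly := fun f => by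
  rw [Metric.mem_closure_range_iff]
  intro ε hε
  obtain ⟨p, hp⟩ := exists_norm_sub_ofPoly_le f (half_pos hε)
  exact ⟨p, by rw [dist_eq_norm]; linarith⟩

/-! ### Balanced factorization of polynomials -/

/-- `f = a b` with `|a| = |b|` on the circle. -/
noncomputable def IsBalancedProduct (f : DiscAlg) : Prop :=
  ∃ a b : DiscAlg, f = a * b ∧ ∀ z : Disc, ‖(z : ℂ)‖ = 1 → ‖a.incl z‖ = ‖b.incl z‖

theorem IsBalancedProduct.mul {f g : DiscAlg} (hf : IsBalancedProduct f)
    (hg : IsBalancedProduct g) : IsBalancedProduct (f * g) := by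
  obtain ⟨a, b, rfl, h⟩ := hf
  obtain ⟨c, d, rfl, h'⟩ := hg
  exact ⟨a * c, b * d, by ring, fun z hz => by simp [h z hz, h' z hz]⟩

theorem isBalancedProduct_algebraMap (c : ℂ) : IsBalancedProduct (algebraMap ℂ DiscAlg c) := by
  obtain ⟨s, hs⟩ := IsAlgClosed.exists_pow_nat_eq c two_pos
  exact ⟨algebraMap ℂ _ s, algebraMap ℂ _ s, by rw [← map_mul, ← hs, sq], fun _ _ => rfl⟩

/-- `1 - v z` has nonnegative real part on the closed disc and positive real part inside, so the
principal square root is holomorphic inside and remains continuous even at a zero on the circle. -/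
theorem exists_sq_eq_one_sub {v : ℂ} (hv : ‖v‖ ≤ 1) :
    ∃ s : DiscAlg, ∀ z, s.incl z ^ 2 = 1 - v * z := by
  have hre : ∀ z : ℂ, ‖z‖ ≤ 1 → ‖v * z‖ ≤ 1 := fun z hz => by
    rw [norm_mul]; exact mul_le_one₀ hv (norm_nonneg _) hz
  have hc : ContinuousOn (fun z : ℂ => (1 - v * z) ^ (1 / 2 : ℂ)) (Metric.closedBall 0 1) := by
    intro z hz
    have := (Complex.re_le_norm (v * z)).trans (hre z (by simpa using hz))
    refine ContinuousAt.continuousWithinAt ?_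
    refine ContinuousAt.comp (g := fun x : ℂ => x ^ (1 / 2 : ℂ)) (f := fun z => 1 - v * z)
      (Complex.continuousAt_cpow_const_of_re_pos (Or.inl ?_) (by norm_num)) (by fun_prop)
    simp only [Complex.sub_re, Complex.one_re]; linarith
  have hd : DifferentiableOn ℂ (fun z : ℂ => (1 - v * z) ^ (1 / 2 : ℂ)) (Metric.ball 0 1) := by
    intro z hz
    have hz' : ‖z‖ < 1 := by simpa using hz
    have : ‖v * z‖ < 1 := by
      rw [norm_mul]
      exact (mul_le_of_le_one_left (norm_nonneg _) hv).trans_lt hz'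
    have := (Complex.re_le_norm (v * z)).trans_lt this
    refine DifferentiableAt.differentiableWithinAt ?_
    refine DifferentiableAt.cpow (by fun_prop) (by fun_prop) (Or.inl ?_)
    simp only [Complex.sub_re, Complex.one_re]; linarith
  refine ⟨DiscAlg.ofFun _ hc hd, fun z => ?_⟩
  rw [DiscAlg.ofFun_apply, ← Complex.cpow_nat_mul]
  norm_num

/-- If `|w| < 1`, then `|z - w| = |1 - conj w z|` on the circle; with `s² = 1 - conj w z` the
factors are `(z - w) / s` and `s`, the Blaschke factor being absorbed in the first. Otherwise `z - w
= -w (1 - z / w)` and `1 - z / w` is itself a square. -/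
theorem isBalancedProduct_ofPoly_X_sub_C (w : ℂ) : IsBalancedProduct (ofPoly (X - C w)) := by
  rcases lt_or_ge ‖w‖ 1 with hw | hw
  · obtain ⟨s, hs⟩ := exists_sq_eq_one_sub (v := conj w) (by simpa using hw.le)
    have hne : ∀ z : Disc, s.incl z ≠ 0 := fun z h0 => by
      have h1 := hs z
      rw [h0, zero_pow two_ne_zero, eq_comm, sub_eq_zero] at h1
      have h2 : ‖conj w * (z : ℂ)‖ < 1 := by
        rw [norm_mul, RCLike.norm_conj]
        exact (mul_le_of_le_one_right (norm_nonneg _) (Disc.norm_le_one z)).trans_lt hw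
      rw [← h1] at h2
      simp at h2
    have hne' : ∀ z ∈ Metric.closedBall (0 : ℂ) 1, extendByZero s.incl z ≠ 0 := fun z hz => by
      rw [show extendByZero s.incl z = s.incl ⟨z, hz⟩ from s.extendByZero_apply ⟨z, hz⟩]
      exact hne _
    refine ⟨DiscAlg.ofFun (fun z => (z - w) / extendByZero s.incl z)
      (ContinuousOn.div (by fun_prop) s.continuousOn_extendByZero hne')
      (DifferentiableOn.div (by fun_prop) s.differentiableOn_extendByZero
        fun z hz => hne' z (Metric.ball_subset_closedBall hz)), s, ?_, ?_⟩
    · refine DiscAlg.ext fun z => ?_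
      rw [map_mul, ContinuousMap.mul_apply, DiscAlg.ofFun_apply, DiscAlg.extendByZero_apply,
        ofPoly_apply, div_mul_cancel₀ _ (hne z)]
      simp
    · intro z hz
      rw [DiscAlg.ofFun_apply, DiscAlg.extendByZero_apply, norm_div,
        div_eq_iff (norm_ne_zero_iff.2 (hne z)), ← sq, ← norm_pow, hs]
      have hzz : (z : ℂ) * conj (z : ℂ) = 1 := by
        rw [Complex.mul_conj, Complex.normSq_eq_norm_sq, hz]; norm_num
      calc ‖(z : ℂ) - w‖ = ‖(z : ℂ) * conj (1 - conj w * z)‖ := by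
            rw [map_sub, map_mul, map_one, Complex.conj_conj, mul_sub, mul_left_comm, hzz]
            ring_nf
        _ = ‖1 - conj w * z‖ := by rw [norm_mul, hz, one_mul, RCLike.norm_conj]
  · have hw0 : w ≠ 0 := norm_ne_zero_iff.1 (by linarith)
    obtain ⟨s, hs⟩ := exists_sq_eq_one_sub (v := w⁻¹) (by rw [norm_inv]; exact inv_le_one_of_one_le₀ hw)
    have h1 : ofPoly (X - C w) = algebraMap ℂ DiscAlg (-w) * (s * s) := by
      refine DiscAlg.ext fun z => ?_
      rw [ofPoly_apply, map_mul, map_mul, ContinuousMap.mul_apply, ContinuousMap.mul_apply,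
        DiscAlg.algebraMap_apply, ← sq, hs]
      simp only [eval_sub, eval_X, eval_C]
      field_simp
      ring
    rw [h1]
    exact (isBalancedProduct_algebraMap _).mul ⟨s, s, rfl, fun _ _ => rfl⟩

/-- Every polynomial is a product of two elements of the disc algebra of equal modulus on the
circle. -/
theorem isBalancedProduct_ofPoly (p : ℂ[X]) : IsBalancedProduct (ofPoly p) := by
  rw [(IsAlgClosed.splits p).eq_prod_roots, ofPoly_mul]
  refine IsBalancedProduct.mul ?_ ?_
  · rw [show ofPoly (C p.leadingCoeff) = algebraMap ℂ DiscAlg p.leadingCoeff from aeval_C _ _]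
    exact isBalancedProduct_algebraMap _
  · induction p.roots using Multiset.induction with
    | empty => simpa [ofPoly_one] using isBalancedProduct_algebraMap 1
    | cons w s ih =>
      rw [Multiset.map_cons, Multiset.prod_cons, ofPoly_mul]
      exact (isBalancedProduct_ofPoly_X_sub_C w).mul ih

/-! ### Fourier analysis on the circle -/

theorem fourier_natCast (n : ℕ) (θ : Torus) : fourier (n : ℤ) θ = (toCircle θ : ℂ) ^ n := by
  rw [fourier_apply, natCast_zsmul, toCircle_nsmul, Circle.coe_pow]

theorem continuous_boundaryPoint : Continuous boundaryPoint :=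
  (continuous_subtype_val.comp continuous_toCircle).subtype_mk _

theorem coe_boundaryPoint (θ : Torus) : (boundaryPoint θ : ℂ) = toCircle θ := rfl

theorem norm_boundaryPoint (θ : Torus) : ‖(boundaryPoint θ : ℂ)‖ = 1 := Circle.norm_coe _

/-- The boundary function of an element of the disc algebra. -/
noncomputable def DiscAlg.trace (f : DiscAlg) (θ : Torus) : ℂ := f.incl (boundaryPoint θ)

theorem DiscAlg.continuous_trace (f : DiscAlg) : Continuous f.trace :=
  f.incl.continuous.comp continuous_boundaryPoint

theorem DiscAlg.norm_trace_le (f : DiscAlg) (θ : Torus) : ‖f.trace θ‖ ≤ ‖f‖ :=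
  f.norm_apply_le _

theorem DiscAlg.trace_mul (f g : DiscAlg) (θ : Torus) :
    (f * g).trace θ = f.trace θ * g.trace θ := by
  simp [DiscAlg.trace]

theorem ofPoly_trace (p : ℂ[X]) (θ : Torus) : (ofPoly p).trace θ = p.eval (toCircle θ : ℂ) :=
  ofPoly_apply p _

theorem memLp_of_continuous {f : Torus → ℂ} (hf : Continuous f) (p : ℝ≥0∞) (μ : Measure Torus)
    [IsFiniteMeasure μ] : MemLp f p μ :=
  MemLp.of_bound hf.aestronglyMeasurable ‖(⟨f, hf⟩ : C(Torus, ℂ))‖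
    (ae_of_all _ fun θ => (⟨f, hf⟩ : C(Torus, ℂ)).norm_coe_le_norm θ)

theorem continuous_eval_toCircle (p : ℂ[X]) :
    Continuous fun θ : Torus => p.eval (toCircle θ : ℂ) :=
  p.continuous.comp (continuous_subtype_val.comp continuous_toCircle)

/-- The boundary function of an element of the disc algebra has no negative Fourier
coefficients. -/
theorem DiscAlg.fourierCoeff_trace_of_neg (f : DiscAlg) {n : ℤ} (hn : n < 0) :
    fourierCoeff f.trace n = 0 := by
  obtain ⟨m, rfl⟩ : ∃ m : ℕ, n = -(m + 1 : ℕ) := ⟨(-n - 1).toNat, by omega⟩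
  -- The coefficient of index `-(m + 1)` is, up to a constant, the contour integral of `z ^ m f`,
  -- which vanishes by Cauchy's theorem.
  set F : ℂ → ℂ := fun z => z ^ m * extendByZero f.incl z
  have hF : (∮ z in C(0, 1), F z) = 0 := by
    refine Complex.circleIntegral_eq_zero_of_differentiable_on_off_countable zero_le_one
      Set.countable_empty ((by fun_prop : ContinuousOn (fun z : ℂ => z ^ m) _).mul
        f.continuousOn_extendByZero) fun z hz => ?_
    exact DifferentiableAt.mul (by fun_prop)
      (f.differentiableOn_extendByZero.differentiableAt (Metric.isOpen_ball.mem_nhds hz.1))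
  have hx : ∀ x : ℝ, ((toCircle (x : Torus) : Circle) : ℂ) = circleMap 0 1 x := fun x => by
    rw [toCircle_apply_mk, Circle.coe_exp]
    simp [circleMap, Real.pi_ne_zero]
  rw [fourierCoeff_eq_intervalIntegral _ _ 0, zero_add]
  refine smul_eq_zero_of_right _ ?_
  have h2 : (∮ z in C(0, 1), F z) = Complex.I *
      ∫ x in (0 : ℝ)..2 * π, fourier (-(-((m + 1 : ℕ) : ℤ))) (x : Torus) • f.trace x := by
    rw [circleIntegral, ← intervalIntegral.integral_const_mul]
    refine intervalIntegral.integral_congr fun x _ => ?_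
    have hm : circleMap 0 1 x ∈ Metric.closedBall (0 : ℂ) 1 := circleMap_mem_closedBall _ zero_le_one _
    have h3 : extendByZero f.incl (circleMap 0 1 x) = f.trace x := by
      rw [show extendByZero f.incl (circleMap 0 1 x) = f.incl ⟨_, hm⟩ from
        f.extendByZero_apply ⟨_, hm⟩, DiscAlg.trace]
      congr 1
      exact Subtype.ext (hx x).symm
    simp only [F, deriv_circleMap, smul_eq_mul, h3, neg_neg, fourier_natCast, hx]
    ring
  rw [hF, eq_comm] at h2
  exact (mul_eq_zero.1 h2).resolve_left Complex.I_ne_zero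

theorem integral_fourier (n : ℤ) :
    ∫ θ : Torus, fourier n θ ∂haarAddCircle = if n = 0 then 1 else 0 := by
  have := congrFun (fourierCoeff_fourier (T := 2 * π) n) 0
  simp only [fourierCoeff, neg_zero, fourier_zero, one_smul] at this
  rw [this, Pi.single_apply]
  simp only [eq_comm]

theorem eval_toCircle (p : ℂ[X]) (θ : Torus) :
    p.eval (toCircle θ : ℂ) = p.sum fun m c => c * fourier (m : ℤ) θ := by
  rw [eval_eq_sum]
  simp only [fourier_natCast]

theorem integrable_fourier_mul {h : Torus → ℂ} (hh : Integrable h haarAddCircle) (n : ℤ) :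
    Integrable (fun θ => fourier n θ * h θ) haarAddCircle := hh.fourier_smul n

theorem integrable_conj {h : Torus → ℂ} {μ : Measure Torus} (hh : Integrable h μ) :
    Integrable (fun θ => conj (h θ)) μ :=
  (RCLike.conjCLE (K := ℂ)).toContinuousLinearMap.integrable_comp hh

theorem integral_fourier_mul_conj (h : Torus → ℂ) (n : ℤ) :
    ∫ θ, fourier n θ * conj (h θ) ∂haarAddCircle = conj (fourierCoeff h n) := by
  rw [fourierCoeff, ← integral_conj]
  simp [fourier_neg, -fourier_apply]

theorem integral_eval_mul_conj {h : Torus → ℂ} (hh : Integrable h haarAddCircle) (p : ℂ[X]) :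
    ∫ θ : Torus, p.eval (toCircle θ : ℂ) * conj (h θ) ∂haarAddCircle =
      p.sum fun m c => c * conj (fourierCoeff h m) := by
  simp only [eval_toCircle, Polynomial.sum, Finset.sum_mul, mul_assoc]
  rw [integral_finsetSum]
  · simp only [integral_const_mul, integral_fourier_mul_conj]
  · exact fun m _ => (integrable_fourier_mul (integrable_conj hh) m).const_mul _

theorem fourierCoeff_eval (p : ℂ[X]) (n : ℕ) :
    fourierCoeff (fun θ : Torus => p.eval (toCircle θ : ℂ)) n = p.coeff n := by
  have h1 : Integrable (fourier (n : ℤ) : Torus → ℂ) haarAddCircle :=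
    memLp_one_iff_integrable.1 (memLp_of_continuous (fourier (n : ℤ)).continuous _ _)
  have h := integral_eval_mul_conj h1 p
  rw [fourierCoeff]
  simp only [smul_eq_mul, fourier_neg]
  simp only [mul_comm (conj _)]
  rw [h]
  simp only [fourierCoeff_fourier, Polynomial.sum]
  rw [Finset.sum_eq_single n]
  · simp
  · intro m _ hm
    simp [hm]
  · intro hn
    simp [notMem_support_iff.1 hn]

theorem integral_eq_haar (f : Torus → ℂ) :
    ∫ θ, f θ = 2 * π * ∫ θ, f θ ∂haarAddCircle := by
  rw [integral_haarAddCircle, Complex.real_smul]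
  push_cast
  field_simp

theorem integral_eq_haar_real (f : Torus → ℝ) :
    ∫ θ, f θ = 2 * π * ∫ θ, f θ ∂haarAddCircle := by
  rw [integral_haarAddCircle, smul_eq_mul]
  field_simp

/-- Parseval: the `n`-th coefficient of `a b` is the inner product of `e_n conj a` with `b`, and the
`i`-th coefficient of `e_n conj a` is the conjugate of `â (n - i)`. -/
theorem hasSum_fourierCoeff_mul {a b : Torus → ℂ} (ha : MemLp a 2 haarAddCircle)
    (hb : MemLp b 2 haarAddCircle) (n : ℤ) :
    HasSum (fun i : ℤ => fourierCoeff a (n - i) * fourierCoeff b i)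
      (fourierCoeff (fun θ => a θ * b θ) n) := by
  have hx : MemLp (fun θ => fourier n θ * conj (a θ)) 2 haarAddCircle := by
    have h1 : MemLp (fun θ => conj (a θ)) 2 haarAddCircle := ha.star
    have h2 : MemLp (fourier n : Torus → ℂ) ∞ haarAddCircle :=
      memLp_of_continuous (fourier n).continuous _ _
    exact h1.mul h2
  have h := (fourierBasis (T := 2 * π)).hasSum_inner_mul_inner (hx.toLp _) (hb.toLp _)
  have hb' : ∀ i, fourierCoeff ((hb.toLp _ : Lp ℂ 2 haarAddCircle) : Torus → ℂ) i =
      fourierCoeff b i := fun i => congrFun (fourierCoeff_congr_ae hb.coeFn_toLp) i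
  have hx' : ∀ i, fourierCoeff ((hx.toLp _ : Lp ℂ 2 haarAddCircle) : Torus → ℂ) i =
      conj (fourierCoeff a (n - i)) := fun i => by
    rw [congrFun (fourierCoeff_congr_ae hx.coeFn_toLp) i, ← integral_fourier_mul_conj, fourierCoeff]
    congr 1
    ext θ
    rw [smul_eq_mul, ← mul_assoc, ← fourier_add]
    ring_nf
  have h3 : fourierCoeff (fun θ => a θ * b θ) n = inner ℂ (hx.toLp _) (hb.toLp _) := by
    rw [L2.inner_def, fourierCoeff]
    refine integral_congr_ae ?_
    filter_upwards [hx.coeFn_toLp, hb.coeFn_toLp] with θ h1 h2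
    rw [h1, h2, RCLike.inner_apply, map_mul, RCLike.conj_conj, fourier_neg, smul_eq_mul]
    ring
  rw [h3]
  have h4 : (fun i : ℤ => fourierCoeff a (n - i) * fourierCoeff b i) = fun i =>
      inner ℂ (hx.toLp _) (fourierBasis (T := 2 * π) i) *
        inner ℂ (fourierBasis (T := 2 * π) i) (hb.toLp _) := by
    funext i
    rw [← inner_conj_symm _ (fourierBasis (T := 2 * π) i), ← HilbertBasis.repr_apply_apply,
      ← HilbertBasis.repr_apply_apply, fourierBasis_repr, fourierBasis_repr, hb', hx',
      RCLike.conj_conj]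
  rw [h4]
  exact h

theorem MemHardy.memLp_haar {p : ℝ≥0∞} {f : Torus → ℂ} (hf : MemHardy p f) :
    MemLp f p haarAddCircle := hf.1.haarAddCircle

/-- Only `0 ≤ i ≤ n` contributes to the convolution. This finiteness is what lets products pass to
coefficientwise limits. -/
theorem MemHardy.fourierCoeff_mul {a b : Torus → ℂ} (ha : MemHardy 2 a) (hb : MemHardy 2 b)
    (n : ℕ) : fourierCoeff (fun θ => a θ * b θ) n =
      ∑ i ∈ Finset.range (n + 1), fourierCoeff a ((n - i : ℕ) : ℤ) * fourierCoeff b (i : ℤ) := by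
  refine (hasSum_fourierCoeff_mul ha.memLp_haar hb.memLp_haar n).unique ?_
  rw [Finset.sum_congr rfl (g := fun i : ℕ => fourierCoeff a ((n : ℤ) - (i : ℤ)) *
      fourierCoeff b (i : ℤ)), show ∑ i ∈ Finset.range (n + 1), fourierCoeff a ((n : ℤ) - (i : ℤ)) *
      fourierCoeff b (i : ℤ) = _ from (Finset.sum_map (Finset.range (n + 1))
      Nat.castEmbedding (fun i : ℤ => fourierCoeff a ((n : ℤ) - i) * fourierCoeff b i)).symm]
  · refine hasSum_sum_of_ne_finset_zero fun i hi => ?_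
    rcases lt_or_ge i 0 with h | h
    · rw [hb.2 i h, mul_zero]
    · rw [ha.2 _, zero_mul]
      by_contra h'
      refine hi (Finset.mem_map.2 ⟨i.toNat, ?_, ?_⟩)
      · rw [Finset.mem_range]; omega
      · simp [h]
  · intro i hi
    have : i ≤ n := Nat.lt_succ_iff.1 (Finset.mem_range.1 hi)
    simp [Nat.cast_sub this]

theorem MemHardy.mul {a b : Torus → ℂ} (ha : MemHardy 2 a) (hb : MemHardy 2 b) :
    MemHardy 1 fun θ => a θ * b θ := by
  refine ⟨hb.1.mul ha.1, fun n hn => ?_⟩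
  refine (hasSum_fourierCoeff_mul ha.memLp_haar hb.memLp_haar n).unique ?_
  convert hasSum_zero with i
  rcases lt_or_ge i 0 with h | h
  · rw [hb.2 i h, mul_zero]
  · rw [ha.2 _ (by omega), zero_mul]

/-- An integrable function all of whose Fourier coefficients vanish is zero almost everywhere. -/
theorem ae_eq_zero_of_fourierCoeff_eq_zero {f : Torus → ℂ} (hf : Integrable f haarAddCircle)
    (h : ∀ n, fourierCoeff f n = 0) : f =ᵐ[haarAddCircle] 0 := by
  have hint : ∀ g : C(Torus, ℂ), Integrable (fun θ => g θ * f θ) haarAddCircle := fun g =>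
    hf.bdd_mul (c := ‖g‖) g.continuous.aestronglyMeasurable (ae_of_all _ g.norm_coe_le_norm)
  have hcont : ∀ g : C(Torus, ℂ), ∫ θ, g θ * f θ ∂haarAddCircle = 0 := by
    let L : C(Torus, ℂ) →L[ℂ] ℂ := LinearMap.mkContinuous
      { toFun := fun g => ∫ θ, g θ * f θ ∂haarAddCircle
        map_add' := fun g₁ g₂ => by
          simp only [ContinuousMap.add_apply, add_mul]
          exact integral_add (hint _) (hint _)
        map_smul' := fun c g => by
          simp only [ContinuousMap.smul_apply, smul_eq_mul, mul_assoc, RingHom.id_apply]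
          exact integral_const_mul _ _ }
      (∫ θ, ‖f θ‖ ∂haarAddCircle) fun g => by
        change ‖∫ θ, g θ * f θ ∂haarAddCircle‖ ≤ _
        rw [← integral_mul_const]
        refine norm_integral_le_of_norm_le (hf.norm.mul_const _) (ae_of_all _ fun θ => ?_)
        rw [norm_mul, mul_comm]
        exact mul_le_mul_of_nonneg_left (g.norm_coe_le_norm θ) (norm_nonneg _)
    have hL : L = 0 := by
      refine ContinuousLinearMap.ext_on (s := Set.range (fourier (T := 2 * π))) ?_ ?_
      · have := span_fourier_closure_eq_top (T := 2 * π)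
        rw [← Submodule.dense_iff_topologicalClosure_eq_top] at this
        exact this
      · rintro _ ⟨n, rfl⟩
        have := h (-n)
        rw [fourierCoeff, neg_neg] at this
        exact this
    exact fun g => congrArg (fun l : C(Torus, ℂ) →L[ℂ] ℂ => l g) hL
  -- Trigonometric polynomials being dense, `f` annihilates all continuous functions. The indicator
  -- of a closed set is a pointwise limit of continuous functions bounded by one, so the integral of
  -- `f` over it vanishes by dominated convergence.
  refine ae_eq_zero_of_forall_setIntegral_isClosed_eq_zero hf fun s hs => ?_
  let δ : ℕ → ℝ := fun n => 1 / ((n : ℝ) + 1)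
  have hδ : ∀ n, 0 < δ n := fun n => Nat.one_div_pos_of_nat
  have hind : ∀ θ, Tendsto (fun n => thickenedIndicator (hδ n) s θ) atTop
      (𝓝 (s.indicator (fun _ => (1 : NNReal)) θ)) := fun θ => by
    have := thickenedIndicator_tendsto_indicator_closure hδ tendsto_one_div_add_atTop_nhds_zero_nat s
    rw [hs.closure_eq, tendsto_pi_nhds] at this
    exact this θ
  have hlim : Tendsto (fun n => ∫ θ, ((thickenedIndicator (hδ n) s θ : ℝ) : ℂ) * f θ ∂haarAddCircle)
      atTop (𝓝 (∫ θ, s.indicator f θ ∂haarAddCircle)) := by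
    refine tendsto_integral_of_dominated_convergence (fun θ => ‖f θ‖) (fun n => ?_) hf.norm
      (fun n => ae_of_all _ fun θ => ?_) (ae_of_all _ fun θ => ?_)
    · refine AEStronglyMeasurable.mul (Continuous.aestronglyMeasurable ?_) hf.1
      exact Complex.continuous_ofReal.comp (NNReal.continuous_coe.comp (thickenedIndicator (hδ n) s).continuous)
    · rw [norm_mul, Complex.norm_real, Real.norm_of_nonneg (NNReal.coe_nonneg _)]
      exact mul_le_of_le_one_left (norm_nonneg _) (by exact_mod_cast thickenedIndicator_le_one (hδ n) s θ)
    · have h1 := (((Complex.continuous_ofReal.comp NNReal.continuous_coe).tendsto _).comp (hind θ)).mul_const (f θ)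
      have h2 : (((s.indicator (fun _ => (1 : NNReal)) θ : NNReal) : ℝ) : ℂ) * f θ = s.indicator f θ := by
        by_cases hθ : θ ∈ s
        · rw [Set.indicator_of_mem hθ, Set.indicator_of_mem hθ]; simp
        · rw [Set.indicator_of_notMem hθ, Set.indicator_of_notMem hθ]; simp
      rw [← h2]
      exact h1
  have hzero : ∀ n, ∫ θ, ((thickenedIndicator (hδ n) s θ : ℝ) : ℂ) * f θ ∂haarAddCircle = 0 := fun n =>
    hcont ⟨fun θ => ((thickenedIndicator (hδ n) s θ : ℝ) : ℂ),
      Complex.continuous_ofReal.comp (NNReal.continuous_coe.comp (thickenedIndicator (hδ n) s).continuous)⟩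
  simp only [hzero] at hlim
  rw [← integral_indicator hs.measurableSet]
  exact tendsto_nhds_unique hlim tendsto_const_nhds

/-! ### Products of two square-integrable Hardy functions -/

theorem hasSum_sq_fourierCoeff_of_memLp {f : Torus → ℂ} (hf : MemLp f 2 haarAddCircle) :
    HasSum (fun i => ‖fourierCoeff f i‖ ^ 2) (∫ θ, ‖f θ‖ ^ 2 ∂haarAddCircle) := by
  have h := hasSum_sq_fourierCoeff (T := 2 * π) (hf.toLp f)
  rw [fourierCoeff_congr_ae hf.coeFn_toLp] at h
  convert h using 1
  refine integral_congr_ae ?_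
  filter_upwards [hf.coeFn_toLp] with θ h1
  rw [h1]

theorem sum_sq_fourierCoeff_le {f : Torus → ℂ} (hf : MemLp f 2 haarAddCircle) (N : ℕ) :
    ∑ j ∈ Finset.range N, ‖fourierCoeff f (j : ℤ)‖ ^ 2 ≤ ∫ θ, ‖f θ‖ ^ 2 ∂haarAddCircle := by
  have h := sum_le_hasSum ((Finset.range N).map Nat.castEmbedding) (fun i _ => by positivity)
    (hasSum_sq_fourierCoeff_of_memLp hf)
  rwa [Finset.sum_map] at h

/-- Riesz–Fischer for `H²`. -/
theorem exists_memHardy_two {a : ℕ → ℂ} {M : ℝ}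
    (h : ∀ N, ∑ j ∈ Finset.range N, ‖a j‖ ^ 2 ≤ M) :
    ∃ f, MemHardy 2 f ∧ ∀ n : ℕ, fourierCoeff f (n : ℤ) = a n := by
  set c : ℤ → ℂ := fun i => if 0 ≤ i then a i.toNat else 0 with hc
  have hcn : ∀ n : ℕ, c n = a n := fun n => by simp [hc]
  have hcneg : ∀ i < 0, c i = 0 := fun i hi => by simp [hc, hi]
  have hs : Summable fun i : ℤ => ‖c i‖ ^ 2 := by
    refine (Nat.cast_injective.summable_iff fun i hi => ?_).1
      ((summable_of_sum_range_le (fun _ => by positivity) h).congr fun n => ?_)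
    · rw [hcneg i, norm_zero, zero_pow two_ne_zero]
      by_contra hi'
      exact hi ⟨i.toNat, by simp; omega⟩
    · rw [Function.comp_apply, hcn]
  have hm : Memℓp c 2 := memℓp_gen (by simpa using hs)
  set F := (fourierBasis (T := 2 * π)).repr.symm ⟨c, hm⟩
  have hF : ∀ i, fourierCoeff F i = c i := fun i => by
    rw [← fourierBasis_repr, LinearIsometryEquiv.apply_symm_apply]
  exact ⟨F, ⟨memLp_haarAddCircle_iff.1 (Lp.memLp F), fun i hi => by rw [hF, hcneg i hi]⟩,
    fun n => by rw [hF, hcn]⟩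

/-- An ultrafilter replaces diagonal subsequences: a single one serves all coefficients of both
factors at once. -/
theorem exists_tendsto_ultrafilter {u : ℕ → ℂ} {C : ℝ} (h : ∀ n : ℕ, ‖u n‖ ≤ C)
    (l : Ultrafilter ℕ) : ∃ x, Tendsto u l (𝓝 x) := by
  obtain ⟨x, -, hx⟩ := (isCompact_closedBall (0 : ℂ) C).ultrafilter_le_nhds (l.map u)
    (le_principal_iff.2 (Ultrafilter.mem_map.2 (Filter.univ_mem' fun n => by simpa using h n)))
  exact ⟨x, hx⟩

theorem memHardy_trace (f : DiscAlg) (p : ℝ≥0∞) : MemHardy p f.trace :=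
  ⟨memLp_of_continuous f.continuous_trace p _, fun _ hn => f.fourierCoeff_trace_of_neg hn⟩

/-- Weak compactness of balls of `H²`, read on coefficients: partial sums of squares stay below `M`
in the limit, and Riesz–Fischer applies. -/
theorem exists_memHardy_two_of_tendsto {A : ℕ → DiscAlg} {M : ℝ}
    (hA : ∀ N, ∫ θ, ‖(A N).trace θ‖ ^ 2 ∂haarAddCircle ≤ M) (l : Ultrafilter ℕ) :
    ∃ a, MemHardy 2 a ∧ ∀ n : ℕ,
      Tendsto (fun N => fourierCoeff (A N).trace (n : ℤ)) l (𝓝 (fourierCoeff a (n : ℤ))) := by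
  have hsum : ∀ N n, ∑ j ∈ Finset.range n, ‖fourierCoeff (A N).trace (j : ℤ)‖ ^ 2 ≤ M :=
    fun N n => (sum_sq_fourierCoeff_le (memHardy_trace _ 2).memLp_haar n).trans (hA N)
  have hb : ∀ (n : ℕ) N, ‖fourierCoeff (A N).trace (n : ℤ)‖ ≤ √M := fun n N => by
    refine Real.le_sqrt_of_sq_le ((Finset.single_le_sum
      (f := fun j : ℕ => ‖fourierCoeff (A N).trace (j : ℤ)‖ ^ 2) (fun _ _ => by positivity)
      (Finset.self_mem_range_succ n)).trans (hsum N (n + 1)))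
  choose α hα using fun n => exists_tendsto_ultrafilter (hb n) l
  obtain ⟨a, ha, haα⟩ := exists_memHardy_two (a := α) (M := M) fun n =>
    le_of_tendsto (tendsto_finsetSum _ fun j _ => ((hα j).norm.pow 2))
      (Eventually.of_forall fun N => hsum N n)
  exact ⟨a, ha, fun n => by rw [haα]; exact hα n⟩

/-- If polynomials with bounded `L¹` norms have convergent coefficients, the limits are the Fourier
coefficients of the product of two functions in `H²`. -/
theorem exists_mul_of_tendsto_coeff {Q : ℕ → ℂ[X]} {M : ℝ} {c : ℕ → ℂ}
    (hQ : ∀ N, ∫ θ : Torus, ‖(Q N).eval (toCircle θ : ℂ)‖ ∂haarAddCircle ≤ M)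
    (hc : ∀ n, Tendsto (fun N => (Q N).coeff n) atTop (𝓝 (c n))) :
    ∃ a b, MemHardy 2 a ∧ MemHardy 2 b ∧
      ∀ n : ℕ, fourierCoeff (fun θ => a θ * b θ) (n : ℤ) = c n := by
  choose A B hAB hn using fun N => isBalancedProduct_ofPoly (Q N)
  have hn' : ∀ N θ, ‖(A N).trace θ‖ = ‖(B N).trace θ‖ := fun N θ => hn N _ (norm_boundaryPoint θ)
  have hmul : ∀ N θ, (Q N).eval (toCircle θ : ℂ) = (A N).trace θ * (B N).trace θ := fun N θ => by
    rw [← DiscAlg.trace_mul, ← hAB, ofPoly_trace]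
  have hB : ∀ N, ∫ θ, ‖(B N).trace θ‖ ^ 2 ∂haarAddCircle ≤ M := fun N => by
    refine le_trans (le_of_eq ?_) (hQ N)
    simp only [hmul, norm_mul, hn', sq]
  have hA : ∀ N, ∫ θ, ‖(A N).trace θ‖ ^ 2 ∂haarAddCircle ≤ M := fun N => by
    simpa only [hn'] using hB N
  -- It refines `atTop`, so limits along it agree with the limits assumed in `hc`.
  let l : Ultrafilter ℕ := hyperfilter ℕ
  obtain ⟨a, ha, hat⟩ := exists_memHardy_two_of_tendsto hA l
  obtain ⟨b, hb, hbt⟩ := exists_memHardy_two_of_tendsto hB l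
  refine ⟨a, b, ha, hb, fun n => tendsto_nhds_unique ?_ ((hc n).mono_left Nat.hyperfilter_le_atTop)⟩
  rw [ha.fourierCoeff_mul hb]
  refine (tendsto_finsetSum (Finset.range (n + 1)) fun i _ => (hat (n - i)).mul (hbt i)).congr
    fun N => ?_
  rw [← (memHardy_trace (A N) 2).fourierCoeff_mul (memHardy_trace (B N) 2), ← fourierCoeff_eval]
  simp only [hmul]

/-! ### Fejér means -/

theorem integrable_of_norm_le {s : Torus → ℂ} (hs : AEStronglyMeasurable s haarAddCircle) {C : ℝ}
    (h : ∀ θ, ‖s θ‖ ≤ C) : Integrable s haarAddCircle :=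
  memLp_one_iff_integrable.1 (MemLp.of_bound hs C (ae_of_all _ h))

/-- The Fejér sum `∑ j k < N, ŝ(j - k) e_{j - k}`, which is `N` times the Fejér mean of `s`. -/
noncomputable def fejerSum (s : Torus → ℂ) (N : ℕ) (θ : Torus) : ℂ :=
  ∑ j ∈ Finset.range N, ∑ k ∈ Finset.range N,
    fourierCoeff s ((j : ℤ) - k) * fourier ((j : ℤ) - k) θ

/-- The sum is the convolution of `s` with `|∑ j < N, e_j|²`, a nonnegative kernel of integral `N`.
-/
theorem norm_fejerSum_le {s : Torus → ℂ} (hs : AEStronglyMeasurable s haarAddCircle)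
    (h : ∀ θ, ‖s θ‖ ≤ 1) (N : ℕ) (θ : Torus) : ‖fejerSum s N θ‖ ≤ N := by
  have hint := integrable_of_norm_le hs h
  set g : Torus → ℂ := fun t => ∑ j ∈ Finset.range N, fourier (j : ℤ) θ * fourier (-(j : ℤ)) t
  have hg : ∀ t, ((‖g t‖ ^ 2 : ℝ) : ℂ) = ∑ j ∈ Finset.range N, ∑ k ∈ Finset.range N,
      fourier (-((j : ℤ) - k)) t * fourier ((j : ℤ) - k) θ := fun t => by
    rw [Complex.ofReal_pow, ← Complex.mul_conj', map_sum, Finset.sum_mul_sum]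
    refine Finset.sum_congr rfl fun j _ => Finset.sum_congr rfl fun k _ => ?_
    rw [map_mul, ← fourier_neg, ← fourier_neg, neg_neg, neg_sub, sub_eq_add_neg, sub_eq_add_neg,
      fourier_add, fourier_add]
    ring
  have hgc : Continuous g := continuous_finsetSum _ fun _ _ => by fun_prop
  have hgi : Integrable (fun t => ((‖g t‖ ^ 2 : ℝ) : ℂ)) haarAddCircle :=
    memLp_one_iff_integrable.1 (memLp_of_continuous (by fun_prop) _ _)
  have h1 : fejerSum s N θ = ∫ t, ((‖g t‖ ^ 2 : ℝ) : ℂ) * s t ∂haarAddCircle := by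
    simp only [hg, Finset.sum_mul]
    rw [integral_finsetSum]
    · refine Finset.sum_congr rfl fun j _ => ?_
      rw [integral_finsetSum]
      · refine Finset.sum_congr rfl fun k _ => ?_
        rw [fourierCoeff, ← integral_mul_const]
        refine integral_congr_ae (ae_of_all _ fun t => ?_)
        simp only [smul_eq_mul]
        ring
      · intro k _
        simp only [mul_right_comm _ _ (s _)]
        exact (integrable_fourier_mul hint _).mul_const _
    · intro j _
      refine integrable_finsetSum _ fun k _ => ?_
      simp only [mul_right_comm _ _ (s _)]
      exact (integrable_fourier_mul hint _).mul_const _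
  have h2 : ∫ t, ((‖g t‖ ^ 2 : ℝ) : ℂ) ∂haarAddCircle = N := by
    have hi : ∀ n : ℤ, Integrable (fun t : Torus => fourier (-n) t * fourier n θ) haarAddCircle :=
      fun n => memLp_one_iff_integrable.1 (memLp_of_continuous (by fun_prop) _ _)
    simp only [hg]
    rw [integral_finsetSum _ fun j _ => integrable_finsetSum _ fun k _ => hi _]
    have : ∀ j ∈ Finset.range N, ∫ t : Torus, ∑ k ∈ Finset.range N,
        fourier (-((j : ℤ) - k)) t * fourier ((j : ℤ) - k) θ ∂haarAddCircle = 1 := fun j hj => by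
      rw [integral_finsetSum _ fun k _ => hi _, Finset.sum_eq_single j]
      · rw [integral_mul_const, integral_fourier]; simp
      · intro k _ hk
        rw [integral_mul_const, integral_fourier, if_neg (by omega), zero_mul]
      · exact fun hj' => absurd hj hj'
    rw [Finset.sum_congr rfl this]
    simp
  rw [h1]
  calc _ ≤ ∫ t, ‖g t‖ ^ 2 ∂haarAddCircle := by
        refine norm_integral_le_of_norm_le (hgi.re.congr
          (ae_of_all _ fun t => Complex.ofReal_re _)) (ae_of_all _ fun t => ?_)
        rw [norm_mul, Complex.norm_real, Real.norm_of_nonneg (by positivity)]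
        exact mul_le_of_le_one_right (by positivity) (h t)
    _ = N := Complex.ofReal_injective (integral_complex_ofReal.symm.trans (by rw [h2]; simp))

theorem sum_range_fourier_reflect {E : Type*} [AddCommMonoid E] (F : ℤ → E) {j N : ℕ} (hj : j < N) :
    ∑ m ∈ Finset.range (j + 1), F m =
      ∑ k ∈ Finset.range N, if k ≤ j then F ((j : ℤ) - k) else 0 := by
  rw [← Finset.sum_range_reflect, ← Finset.sum_filter]
  refine Finset.sum_congr ?_ fun k hk => ?_
  · ext k; simp; omega
  · have : k ≤ j := (Finset.mem_filter.1 hk).2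
    congr 1
    omega

/-- The pairs `j < k` drop out because `q` has no negative coefficients; the rest is indexed by `m =
j - k`. -/
theorem integral_mul_conj_fejerSum {q : Torus → ℂ} (hq : MemHardy 1 q) (s : Torus → ℂ) (N : ℕ) :
    ∫ θ, q θ * conj (fejerSum s N θ) ∂haarAddCircle =
      ∑ j ∈ Finset.range N, ∑ m ∈ Finset.range (j + 1),
        fourierCoeff q (m : ℤ) * conj (fourierCoeff s (m : ℤ)) := by
  have hint : Integrable q haarAddCircle := memLp_one_iff_integrable.1 hq.memLp_haar
  have hi : ∀ n : ℤ, Integrable (fun θ => conj (fourierCoeff s n) * (fourier (-n) θ * q θ))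
      haarAddCircle := fun n => (integrable_fourier_mul hint _).const_mul _
  have h1 : ∀ θ, q θ * conj (fejerSum s N θ) = ∑ j ∈ Finset.range N, ∑ k ∈ Finset.range N,
      conj (fourierCoeff s ((j : ℤ) - k)) * (fourier (-((j : ℤ) - k)) θ * q θ) := fun θ => by
    simp only [fejerSum, map_sum, Finset.mul_sum, map_mul]
    refine Finset.sum_congr rfl fun j _ => Finset.sum_congr rfl fun k _ => ?_
    rw [← fourier_neg]
    ring
  simp only [h1]
  rw [integral_finsetSum _ fun j _ => integrable_finsetSum _ fun k _ => hi _]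
  refine Finset.sum_congr rfl fun j hj => ?_
  rw [integral_finsetSum _ fun k _ => hi _, sum_range_fourier_reflect
    (fun m => fourierCoeff q m * conj (fourierCoeff s m)) (Finset.mem_range.1 hj)]
  refine Finset.sum_congr rfl fun k _ => ?_
  rw [integral_const_mul, mul_comm]
  split_ifs with h
  · rfl
  · have : fourierCoeff q ((j : ℤ) - k) = 0 := hq.2 _ (by omega)
    rw [fourierCoeff] at this
    simp only [smul_eq_mul] at this
    rw [this, zero_mul]

/-- A sequence whose pairing with Fejér means of real functions of modulus at most one is bounded
is the sequence of Fourier coefficients of the product of two functions in `H²`. -/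
theorem exists_mul_of_cesaro_bound {c : ℕ → ℂ} {M : ℝ}
    (H : ∀ s : Torus → ℝ, Measurable s → (∀ θ, |s θ| ≤ 1) → ∀ N : ℕ,
      ‖∑ j ∈ Finset.range N, ∑ m ∈ Finset.range (j + 1),
        c m * conj (fourierCoeff (fun θ => (s θ : ℂ)) (m : ℤ))‖ ≤ M * N) :
    ∃ a b, MemHardy 2 a ∧ MemHardy 2 b ∧
      ∀ n : ℕ, fourierCoeff (fun θ => a θ * b θ) (n : ℤ) = c n := by
  -- The Cesàro means of `∑ c m z ^ m`; the hypothesis bounds `∫ Q s` for real `s`. For `N = 0` the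
  -- polynomial is zero.
  set Q : ℕ → ℂ[X] := fun N => C ((N : ℂ)⁻¹) *
    ∑ j ∈ Finset.range N, ∑ m ∈ Finset.range (j + 1), monomial m (c m)
  have hM : 0 ≤ M := by
    simpa using (norm_nonneg _).trans (H (fun _ => 0) measurable_const (by simp) 1)
  have hQs : ∀ N, ∀ s : Torus → ℝ, Measurable s → (∀ θ, |s θ| ≤ 1) →
      ‖∫ θ : Torus, (Q N).eval (toCircle θ : ℂ) * (s θ : ℂ) ∂haarAddCircle‖ ≤ M := by
    intro N s hs hs1
    have hsm : Measurable fun θ => (s θ : ℂ) := Complex.measurable_ofReal.comp hs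
    have hsi : Integrable (fun θ => (s θ : ℂ)) haarAddCircle :=
      integrable_of_norm_le hsm.aestronglyMeasurable (C := 1) fun θ => by simpa using hs1 θ
    have hmon : ∀ m : ℕ, ∫ θ : Torus, (monomial m (c m)).eval (toCircle θ : ℂ) * (s θ : ℂ)
        ∂haarAddCircle = c m * conj (fourierCoeff (fun θ => (s θ : ℂ)) (m : ℤ)) := fun m => by
      have := integral_eval_mul_conj hsi (monomial m (c m))
      rw [sum_monomial_index _ _ (by simp)] at this
      simpa only [Complex.conj_ofReal] using this
    have hmi : ∀ m : ℕ, Integrable (fun θ : Torus =>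
        (monomial m (c m)).eval (toCircle θ : ℂ) * (s θ : ℂ)) haarAddCircle := fun m => by
      simp only [eval_monomial, ← fourier_natCast, mul_assoc]
      exact (integrable_fourier_mul hsi _).const_mul _
    have h1 : ∫ θ : Torus, (Q N).eval (toCircle θ : ℂ) * (s θ : ℂ) ∂haarAddCircle = (N : ℂ)⁻¹ *
        ∑ j ∈ Finset.range N, ∑ m ∈ Finset.range (j + 1),
          c m * conj (fourierCoeff (fun θ => (s θ : ℂ)) (m : ℤ)) := by
      simp only [Q, eval_mul, eval_C, eval_finsetSum, mul_assoc, Finset.sum_mul]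
      rw [integral_const_mul,
        integral_finsetSum _ fun j _ => integrable_finsetSum _ fun m _ => hmi m]
      congr 1
      refine Finset.sum_congr rfl fun j _ => ?_
      rw [integral_finsetSum _ fun m _ => hmi m]
      exact Finset.sum_congr rfl fun m _ => hmon m
    rw [h1, norm_mul, norm_inv, Complex.norm_natCast]
    rcases Nat.eq_zero_or_pos N with rfl | hN
    · simpa using hM
    · rw [inv_mul_le_iff₀ (by exact_mod_cast hN)]
      exact (H s hs hs1 N).trans_eq (mul_comm _ _)
  refine exists_mul_of_tendsto_coeff (Q := Q) (M := M + M) (fun N => ?_) fun n => ?_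
  · set q : Torus → ℂ := fun θ => (Q N).eval (toCircle θ : ℂ)
    have hqc : Continuous q := continuous_eval_toCircle _
    -- The conjugate sign of `q`, equal to zero where `q` vanishes. Its real and imaginary parts are
    -- admissible test functions, one `M` for each.
    set σ : Torus → ℂ := fun θ => conj (q θ) / ‖q θ‖
    have hσm : Measurable σ := ((RCLike.continuous_conj.comp hqc).measurable).div
      (Complex.measurable_ofReal.comp hqc.norm.measurable)
    have hσ1 : ∀ θ, ‖σ θ‖ ≤ 1 := fun θ => by
      simp only [σ, norm_div, RCLike.norm_conj, Complex.norm_real, norm_norm]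
      exact div_self_le_one _
    have hqσ : ∀ θ, ((‖q θ‖ : ℝ) : ℂ) = q θ * ((σ θ).re : ℂ) + Complex.I * (q θ * ((σ θ).im : ℂ)) := by
      intro θ
      rw [mul_left_comm, ← mul_add, mul_comm Complex.I, Complex.re_add_im]
      simp only [σ]
      rw [mul_div_assoc', Complex.mul_conj']
      by_cases h0 : ‖q θ‖ = 0
      · simp [h0]
      · field_simp
    have hi : ∀ s : Torus → ℝ, Measurable s → (∀ θ, |s θ| ≤ 1) →
        Integrable (fun θ => q θ * (s θ : ℂ)) haarAddCircle := fun s hs hs1 =>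
      (memLp_one_iff_integrable.1 (memLp_of_continuous hqc _ _)).mul_bdd (c := 1)
        (Complex.measurable_ofReal.comp hs).aestronglyMeasurable
        (ae_of_all _ fun θ => by simpa using hs1 θ)
    have hre1 : ∀ θ, |(σ θ).re| ≤ 1 := fun θ => (Complex.abs_re_le_norm _).trans (hσ1 θ)
    have him1 : ∀ θ, |(σ θ).im| ≤ 1 := fun θ => (Complex.abs_im_le_norm _).trans (hσ1 θ)
    have hrem : Measurable fun θ => (σ θ).re := Complex.measurable_re.comp hσm
    have himm : Measurable fun θ => (σ θ).im := Complex.measurable_im.comp hσm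
    have h2 : ((∫ θ, ‖q θ‖ ∂haarAddCircle : ℝ) : ℂ) = ∫ θ, q θ * ((σ θ).re : ℂ) ∂haarAddCircle +
        Complex.I * ∫ θ, q θ * ((σ θ).im : ℂ) ∂haarAddCircle := by
      rw [← integral_const_mul, ← integral_add (hi _ hrem hre1) ((hi _ himm him1).const_mul _),
        ← integral_complex_ofReal]
      exact integral_congr_ae (ae_of_all _ hqσ)
    calc ∫ θ, ‖q θ‖ ∂haarAddCircle = ‖((∫ θ, ‖q θ‖ ∂haarAddCircle : ℝ) : ℂ)‖ := by
          rw [Complex.norm_real, Real.norm_of_nonneg (integral_nonneg fun _ => norm_nonneg _)]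
      _ ≤ M + M := by
          rw [h2]
          refine (norm_add_le _ _).trans (add_le_add (hQs N _ hrem hre1) ?_)
          rw [norm_mul, Complex.norm_I, one_mul]
          exact hQs N _ himm him1
  -- The `n`-th coefficient of `Q N` is the average of a sequence that equals `c n` from `j = n` on.
  · have h1 : Tendsto (fun j : ℕ => if n < j + 1 then c n else 0) atTop (𝓝 (c n)) :=
      tendsto_const_nhds.congr' ((eventually_ge_atTop n).mono fun j hj =>
        (if_pos (Nat.lt_succ_of_le hj)).symm)
    refine h1.cesaro_smul.congr fun N => ?_
    simp only [Q, coeff_C_mul, finsetSum_coeff, coeff_monomial, Finset.sum_ite_eq',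
      Finset.mem_range, Complex.real_smul, Complex.ofReal_inv, Complex.ofReal_natCast]

/-! ### The decomposition of `H¹_0` -/

theorem fourierCoeff_fourier_mul (f : Torus → ℂ) (m n : ℤ) :
    fourierCoeff (fun θ => fourier m θ * f θ) n = fourierCoeff f (n - m) := by
  simp only [fourierCoeff, smul_eq_mul, ← mul_assoc, ← fourier_add]
  ring_nf

theorem integral_eq_fourierCoeff_zero (f : Torus → ℂ) : ∫ θ, f θ = 2 * π * fourierCoeff f 0 := by
  rw [integral_eq_haar, fourierCoeff]
  simp only [neg_zero, fourier_zero, one_smul]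

theorem MemHardyZero.fourierCoeff_zero {p : ℝ≥0∞} {f : Torus → ℂ} (hf : MemHardyZero p f) :
    fourierCoeff f 0 = 0 := by
  have h := hf.2
  rw [integral_eq_fourierCoeff_zero] at h
  exact (mul_eq_zero.1 h).resolve_left (by simp [Real.pi_ne_zero])

theorem memLp_fourier_mul {p : ℝ≥0∞} {f : Torus → ℂ} (hf : MemLp f p volume) (m : ℤ) :
    MemLp (fun θ => fourier m θ * f θ) p volume :=
  hf.mul (memLp_of_continuous (fourier m).continuous ∞ _)

theorem MemHardy.fourier_one_mul {p : ℝ≥0∞} {f : Torus → ℂ} (hf : MemHardy p f) :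
    MemHardyZero p fun θ => fourier 1 θ * f θ := by
  refine ⟨⟨memLp_fourier_mul hf.1 1, fun n hn => ?_⟩, ?_⟩
  · rw [fourierCoeff_fourier_mul, hf.2 _ (by omega)]
  · rw [integral_eq_fourierCoeff_zero, fourierCoeff_fourier_mul, hf.2 _ (by omega), mul_zero]

theorem MemHardy.integrable_haar {f : Torus → ℂ} (hf : MemHardy 1 f) :
    Integrable f haarAddCircle := memLp_one_iff_integrable.1 hf.memLp_haar

theorem integrable_of_continuous {f : Torus → ℂ} (hf : Continuous f) : Integrable f haarAddCircle :=
  memLp_one_iff_integrable.1 (memLp_of_continuous hf _ _)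

theorem volume_absolutelyContinuous_haar :
    (volume : Measure Torus) ≪ haarAddCircle := by
  rw [volume_eq_smul_haarAddCircle]
  exact Measure.smul_absolutelyContinuous

theorem MemHardy.linearCombination {f g : Torus → ℂ} {p : ℝ≥0∞} (hp : 1 ≤ p) (hf : MemHardy p f)
    (hg : MemHardy p g) (x y : ℂ) : MemHardy p fun θ => x * f θ + y * g θ := by
  refine ⟨(hf.1.const_mul x).add (hg.1.const_mul y), fun n hn => ?_⟩
  have h := congrFun (fourierCoeff.add ((hf.memLp_haar.const_mul x).integrable hp)
    ((hg.memLp_haar.const_mul y).integrable hp)) n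
  refine h.trans ?_
  rw [Pi.add_apply, fourierCoeff.const_mul, fourierCoeff.const_mul, hf.2 n hn, hg.2 n hn]
  simp

/-- Every function in `H¹` is the product of two functions in `H²`. -/
theorem MemHardy.exists_eq_mul {q : Torus → ℂ} (hq : MemHardy 1 q) :
    ∃ a b, MemHardy 2 a ∧ MemHardy 2 b ∧ q =ᵐ[volume] fun θ => a θ * b θ := by
  obtain ⟨a, b, ha, hb, hab⟩ := exists_mul_of_cesaro_bound (c := fun n => fourierCoeff q (n : ℤ))
    (M := ∫ θ, ‖q θ‖ ∂haarAddCircle) fun s hs hs1 N => by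
      have hsm : Measurable fun θ => (s θ : ℂ) := Complex.measurable_ofReal.comp hs
      rw [← integral_mul_conj_fejerSum hq, ← integral_mul_const]
      refine norm_integral_le_of_norm_le (hq.integrable_haar.norm.mul_const _)
        (ae_of_all _ fun θ => ?_)
      rw [norm_mul, RCLike.norm_conj]
      exact mul_le_mul_of_nonneg_left (norm_fejerSum_le hsm.aestronglyMeasurable
        (fun θ => by simpa using hs1 θ) N θ) (norm_nonneg _)
  refine ⟨a, b, ha, hb, volume_absolutelyContinuous_haar.ae_le ?_⟩
  have hint := hq.integrable_haar
  have hint' := (ha.mul hb).integrable_haar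
  have h := ae_eq_zero_of_fourierCoeff_eq_zero (hint.sub hint') fun n => by
    have h1 : fourierCoeff (q - fun θ => a θ * b θ) n =
        fourierCoeff q n - fourierCoeff (fun θ => a θ * b θ) n := by
      have := integral_sub (hint.fourier_smul (-n)) (hint'.fourier_smul (-n))
      simp only [← smul_sub] at this
      exact this
    rw [h1]
    rcases lt_or_ge n 0 with hn | hn
    · rw [hq.2 n hn, (ha.mul hb).2 n hn, sub_zero]
    · lift n to ℕ using hn
      rw [hab, sub_self]
  filter_upwards [h] with θ hθ
  exact sub_eq_zero.1 hθ

/-- With `h = α z + z² a b`, the two squares are those of `z (a + b) / 2` and `i z (a - b) / 2`. -/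
theorem MemHardyZero.exists_isDecomposition {h : Torus → ℂ} (hh : MemHardyZero 1 h) :
    ∃ (α : ℂ) (k₁ k₂ : Torus → ℂ), IsDecomposition h α k₁ k₂ := by
  set α := fourierCoeff h 1
  have hint := hh.1.integrable_haar
  have hs : Integrable (fun θ : Torus => α * fourier 1 θ) haarAddCircle :=
    integrable_of_continuous (by fun_prop)
  -- Dividing by `z²` is allowed since the coefficient at 0 vanishes and `α` removes the one at 1.
  -- One factor `z` then goes to each factor of the product, which puts `k₁` and `k₂` in `H²_0`.
  have hq : MemHardy 1 fun θ : Torus => fourier (-2) θ * (h θ - α * fourier 1 θ) := by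
    refine ⟨memLp_fourier_mul (f := fun θ : Torus => h θ - α * fourier 1 θ)
      (hh.1.1.sub (memLp_of_continuous (by fun_prop) _ _)) _, fun n hn => ?_⟩
    have h1 : fourierCoeff (fun θ : Torus => h θ - α * fourier 1 θ) (n + 2) =
        fourierCoeff h (n + 2) - fourierCoeff (fun θ : Torus => α * fourier 1 θ) (n + 2) := by
      have := integral_sub (hint.fourier_smul (-(n + 2))) (hs.fourier_smul (-(n + 2)))
      simp only [← smul_sub] at this
      exact this
    rw [fourierCoeff_fourier_mul, sub_neg_eq_add, h1, fourierCoeff.const_mul, fourierCoeff_fourier,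
      Pi.single_apply]
    split_ifs with hn1
    · rw [hn1, mul_one, sub_self]
    · rw [mul_zero, sub_zero]
      rcases (show n + 2 ≤ 0 by omega).lt_or_eq with h2 | h2
      · exact hh.1.2 _ h2
      · rw [h2, hh.fourierCoeff_zero]
  obtain ⟨a, b, ha, hb, hab⟩ := hq.exists_eq_mul
  refine ⟨α, fun θ => fourier 1 θ * ((1 / 2) * a θ + (1 / 2) * b θ),
    fun θ => fourier 1 θ * ((Complex.I / 2) * a θ + (-Complex.I / 2) * b θ),
    (ha.linearCombination (by norm_num) hb _ _).fourier_one_mul,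
    (ha.linearCombination (by norm_num) hb _ _).fourier_one_mul, ?_⟩
  filter_upwards [hab] with θ hθ
  have h2 : fourier (T := 2 * π) 1 θ * fourier 1 θ * fourier (-2) θ = 1 := by
    rw [← fourier_add, ← fourier_add]; simp
  have h3 : h θ = α * fourier 1 θ + fourier 1 θ * fourier 1 θ * (a θ * b θ) := by
    rw [← hθ, ← mul_assoc, h2]; ring
  rw [h3, ← fourier_one]
  linear_combination (-(fourier 1 θ) ^ 2 * (a θ - b θ) ^ 2 / 4) * Complex.I_sq

/-! ### Derivations -/

theorem exists_boundaryPoint_eq {z : Disc} (hz : ‖(z : ℂ)‖ = 1) : ∃ θ, boundaryPoint θ = z := by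
  refine ⟨((Complex.arg z : ℝ) : Torus), Subtype.ext ?_⟩
  rw [coe_boundaryPoint, toCircle_apply_mk, Circle.coe_exp]
  conv_rhs => rw [← Complex.norm_mul_exp_arg_mul_I (z : ℂ), hz]
  simp [Real.pi_ne_zero]

/-- The maximum principle for the disc algebra. -/
theorem DiscAlg.norm_le_of_trace {f : DiscAlg} {C : ℝ} (hC : 0 ≤ C)
    (h : ∀ θ, ‖f.trace θ‖ ≤ C) : ‖f‖ ≤ C := by
  rw [DiscAlg.norm_le hC]
  intro z
  rw [← f.extendByZero_apply]
  have hcl : closure (Metric.ball (0 : ℂ) 1) = Metric.closedBall 0 1 :=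
    closure_ball _ one_ne_zero
  refine Complex.norm_le_of_forall_mem_frontier_norm_le (U := Metric.ball (0 : ℂ) 1)
    Metric.isBounded_ball ⟨f.differentiableOn_extendByZero, ?_⟩ (fun w hw => ?_) ?_
  · rw [hcl]; exact f.continuousOn_extendByZero
  · rw [frontier_ball _ one_ne_zero, mem_sphere_zero_iff_norm] at hw
    obtain ⟨θ, hθ⟩ := exists_boundaryPoint_eq (z := ⟨w, by simp [hw]⟩) hw
    have h1 := h θ
    rw [DiscAlg.trace, hθ, ← f.extendByZero_apply] at h1
    exact h1
  · rw [hcl]; exact z.2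

/-- The exponential of an element of the disc algebra. -/
noncomputable def DiscAlg.exp (f : DiscAlg) : DiscAlg :=
  DiscAlg.ofFun (fun z => Complex.exp (extendByZero f.incl z)) f.continuousOn_extendByZero.cexp
    f.differentiableOn_extendByZero.cexp

theorem DiscAlg.exp_apply (f : DiscAlg) (z : Disc) :
    f.exp.incl z = Complex.exp (f.incl z) := by
  rw [DiscAlg.exp, DiscAlg.ofFun_apply, DiscAlg.extendByZero_apply]

theorem DiscAlg.exp_neg_mul_exp (f : DiscAlg) : (-f).exp * f.exp = 1 := by
  refine DiscAlg.ext fun z => ?_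
  rw [map_mul, ContinuousMap.mul_apply, DiscAlg.exp_apply, DiscAlg.exp_apply, ← Complex.exp_add]
  simp

theorem DiscAlg.isometry_incl : Isometry DiscAlg.incl :=
  AddMonoidHomClass.isometry_of_norm DiscAlg.incl DiscAlg.norm_incl

/-- Norm convergence of the series allows a bounded derivation to be applied term by term. -/
theorem DiscAlg.hasSum_exp (f : DiscAlg) :
    HasSum (fun n : ℕ => ((n.factorial : ℂ)⁻¹) • f ^ n) f.exp := by
  rw [← DiscAlg.isometry_incl.isUniformInducing.isInducing.hasSum_iff]
  have h := NormedSpace.exp_series_hasSum_exp' (𝕂 := ℂ) f.incl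
  have h1 : NormedSpace.exp f.incl = f.exp.incl := by
    ext z
    rw [DiscAlg.exp_apply, Complex.exp_eq_exp_ℂ]
    have h2 := (h.map (ContinuousMap.evalCLM ℂ z) (ContinuousMap.evalCLM ℂ z).continuous)
    have h3 := NormedSpace.exp_series_hasSum_exp' (𝕂 := ℂ) (f.incl z)
    exact h2.unique h3
  rw [h1] at h
  have h4 : (DiscAlg.incl ∘ fun n : ℕ => ((n.factorial : ℂ)⁻¹) • f ^ n) =
      fun n : ℕ => ((n.factorial : ℂ)⁻¹) • f.incl ^ n := by
    funext n
    rw [Function.comp_apply, map_smul, map_pow]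
  rw [h4]
  exact h

/-! ### Derivations on powers, exponentials and polynomials -/

namespace IsDerivation

variable {D : DiscAlg →L[ℂ] StrongDual ℂ DiscAlg}

theorem map_one (hD : IsDerivation D) (c : DiscAlg) : D 1 c = 0 := by
  have h := hD 1 1 c
  rw [mul_one, mul_one] at h
  simpa using h

theorem map_pow_succ (hD : IsDerivation D) (f c : DiscAlg) (n : ℕ) :
    D (f ^ (n + 1)) c = (n + 1) * D f (c * f ^ n) := by
  induction n generalizing c with
  | zero => simp
  | succ n ih =>
    rw [pow_succ, hD, ih, mul_assoc c f, ← pow_succ']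
    push_cast
    ring

theorem map_exp (hD : IsDerivation D) (f c : DiscAlg) : D f.exp c = D f (c * f.exp) := by
  have h1 : HasSum (fun n : ℕ => ((n.factorial : ℂ)⁻¹) * D (f ^ n) c) (D f.exp c) := by
    have := (D.flip c).hasSum f.hasSum_exp
    simpa using this
  have h2 : HasSum (fun n : ℕ => ((n.factorial : ℂ)⁻¹) * D f (c * f ^ n)) (D f (c * f.exp)) := by
    have := (D f).hasSum (f.hasSum_exp.mul_left c)
    simpa using this
  -- The term `n = 0` vanishes because `D 1 = 0`; after the shift, `(n + 1) / (n + 1)! = 1 / n!`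
  -- matches the two series.
  rw [← hasSum_nat_add_iff' 1] at h1
  simp only [Finset.sum_range_one, pow_zero, hD.map_one, mul_zero, sub_zero] at h1
  have h3 : (fun n : ℕ => (((n + 1).factorial : ℂ)⁻¹) * D (f ^ (n + 1)) c) =
      fun n : ℕ => ((n.factorial : ℂ)⁻¹) * D f (c * f ^ n) := ?_
  · rw [h3] at h1
    exact h1.unique h2
  funext n
  rw [hD.map_pow_succ, Nat.factorial_succ]
  have : (n.factorial : ℂ) ≠ 0 := by exact_mod_cast n.factorial_ne_zero
  have : (n : ℂ) + 1 ≠ 0 := Nat.cast_add_one_ne_zero n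
  push_cast
  field_simp

/-- The functional `f ↦ D f 1` is controlled by the real part of `f`. -/
theorem norm_apply_one_le (hD : IsDerivation D) (f : DiscAlg) {C : ℝ}
    (hf : ∀ θ, |(f.trace θ).re| ≤ C) : ‖D f 1‖ ≤ ‖D‖ * Real.exp C * Real.exp C := by
  -- The chain rule for `exp` brings in `e^f` and `e^{-f}`, whose moduli depend on the real part of
  -- `f` only.
  have h1 : D f 1 = D f.exp (-f).exp := by rw [hD.map_exp, DiscAlg.exp_neg_mul_exp]
  have h2 : ‖f.exp‖ ≤ Real.exp C := DiscAlg.norm_le_of_trace (Real.exp_pos _).le fun θ => by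
    rw [DiscAlg.trace, DiscAlg.exp_apply, Complex.norm_exp]
    exact Real.exp_le_exp.2 ((le_abs_self _).trans (hf θ))
  have h3 : ‖(-f).exp‖ ≤ Real.exp C := DiscAlg.norm_le_of_trace (Real.exp_pos _).le fun θ => by
    rw [DiscAlg.trace, DiscAlg.exp_apply, Complex.norm_exp, map_neg, ContinuousMap.neg_apply,
      Complex.neg_re]
    exact Real.exp_le_exp.2 ((neg_le_abs _).trans (hf θ))
  rw [h1]
  exact (D.le_opNorm₂ _ _).trans (by gcongr)

theorem map_ofPoly (hD : IsDerivation D) (p : ℂ[X]) (c : DiscAlg) :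
    D (ofPoly p) c = D coord (c * ofPoly (derivative p)) := by
  induction p using Polynomial.induction_on' with
  | add p q hp hq =>
    rw [ofPoly_add, derivative_add, ofPoly_add, mul_add, map_add, map_add, ← hp, ← hq]
    rfl
  | monomial n a =>
    have h1 : ∀ n : ℕ, ∀ a : ℂ, ofPoly (monomial n a) = a • coord ^ n := fun n a => by
      rw [ofPoly, aeval_monomial, Algebra.smul_def]
    rw [derivative_monomial, h1, h1, map_smul]
    rcases n with _ | n
    · simp [hD.map_one]
    · rw [mul_smul_comm, map_smul, smul_apply, hD.map_pow_succ]
      simp only [smul_eq_mul, Nat.add_sub_cancel]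
      push_cast
      ring

/-- Both sides are the value of `D coord` at `f' g`. -/
theorem map_ofPoly_ofPoly (hD : IsDerivation D) (f g : ℂ[X]) :
    D (ofPoly f) (ofPoly g) = D (ofPoly (primitive (derivative f * g))) 1 := by
  rw [hD.map_ofPoly, hD.map_ofPoly, derivative_primitive, ofPoly_mul, one_mul, mul_comm]

end IsDerivation

/-! ### Fejér sums of real functions and existence of the symbol -/

theorem norm_fourierCoeff_le {s : Torus → ℂ} (h : ∀ θ, ‖s θ‖ ≤ 1) (n : ℤ) :
    ‖fourierCoeff s n‖ ≤ 1 := by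
  rw [fourierCoeff]
  refine (norm_integral_le_of_norm_le_const (C := 1) (ae_of_all _ fun θ => ?_)).trans (by simp)
  rw [norm_smul, fourier_apply, Circle.norm_coe, one_mul]
  exact h θ

theorem fourierCoeff_ofReal_neg (s : Torus → ℝ) (n : ℤ) :
    fourierCoeff (fun θ => (s θ : ℂ)) (-n) = conj (fourierCoeff (fun θ => (s θ : ℂ)) n) := by
  rw [← integral_fourier_mul_conj, fourierCoeff]
  simp

/-- The analytic part of the Fejér sum. -/
noncomputable def analyticFejer (s : Torus → ℂ) (N : ℕ) : ℂ[X] :=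
  ∑ j ∈ Finset.range N, ∑ m ∈ Finset.range (j + 1), monomial m (fourierCoeff s (m : ℤ))

/-- As `s` is real, the terms for `(j, k)` and `(k, j)` are conjugate. Doubling the half `k ≤ j`
counts the diagonal twice, whence the correction by `N ŝ(0)`. -/
theorem re_fejerSum (s : Torus → ℝ) (N : ℕ) (θ : Torus) :
    (fejerSum (fun θ => (s θ : ℂ)) N θ).re =
      2 * ((analyticFejer (fun θ => (s θ : ℂ)) N).eval (toCircle θ : ℂ)).re -
        N * (fourierCoeff (fun θ => (s θ : ℂ)) 0).re := by
  set F : ℤ → ℂ := fun n => fourierCoeff (fun θ => (s θ : ℂ)) n * fourier n θ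
  have hF : ∀ n, (F (-n)).re = (F n).re := fun n => by
    simp only [F]
    rw [fourierCoeff_ofReal_neg, fourier_neg, ← map_mul, Complex.conj_re]
  have h1 : ((analyticFejer (fun θ => (s θ : ℂ)) N).eval (toCircle θ : ℂ)).re =
      ∑ j ∈ Finset.range N, ∑ k ∈ Finset.range N, if k ≤ j then (F ((j : ℤ) - k)).re else 0 := by
    rw [analyticFejer, eval_finsetSum, Complex.re_sum]
    refine Finset.sum_congr rfl fun j hj => ?_
    rw [← sum_range_fourier_reflect (fun n => (F n).re) (Finset.mem_range.1 hj), eval_finsetSum,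
      Complex.re_sum]
    refine Finset.sum_congr rfl fun m _ => ?_
    rw [eval_monomial, ← fourier_natCast]
  have h2 : ∑ j ∈ Finset.range N, ∑ k ∈ Finset.range N, (if k ≤ j then (F ((j : ℤ) - k)).re else 0) =
      ∑ j ∈ Finset.range N, ∑ k ∈ Finset.range N, if j ≤ k then (F ((j : ℤ) - k)).re else 0 := by
    rw [Finset.sum_comm]
    refine Finset.sum_congr rfl fun j _ => Finset.sum_congr rfl fun k _ => ?_
    rw [← hF, neg_sub]
  have h3 : (N : ℝ) * (fourierCoeff (fun θ => (s θ : ℂ)) 0).re =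
      ∑ j ∈ Finset.range N, ∑ k ∈ Finset.range N, if k = j then (F ((j : ℤ) - k)).re else 0 := by
    rw [Finset.sum_congr rfl (g := fun _ => (fourierCoeff (fun θ => (s θ : ℂ)) 0).re)]
    · simp
    · intro j hj
      rw [Finset.sum_ite_eq' , if_pos hj, sub_self]
      simp [F]
  rw [two_mul]
  nth_rewrite 2 [h1]
  rw [h2, h1, h3, fejerSum, Complex.re_sum, ← Finset.sum_add_distrib, ← Finset.sum_sub_distrib]
  refine Finset.sum_congr rfl fun j _ => ?_
  rw [Complex.re_sum, ← Finset.sum_add_distrib, ← Finset.sum_sub_distrib]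
  refine Finset.sum_congr rfl fun k _ => ?_
  change (F ((j : ℤ) - k)).re = _
  rcases lt_trichotomy j k with h | h | h
  · simp [h.le, h.ne', h.not_ge]
  · simp [h]
  · simp [h.le, h.ne, h.not_ge]

theorem abs_re_analyticFejer_le {s : Torus → ℝ} (hs : Measurable s) (hs1 : ∀ θ, |s θ| ≤ 1) (N : ℕ)
    (θ : Torus) : |((analyticFejer (fun θ => (s θ : ℂ)) N).eval (toCircle θ : ℂ)).re| ≤ N := by
  have hsm : Measurable fun θ => (s θ : ℂ) := Complex.measurable_ofReal.comp hs
  have hs2 : ∀ θ, ‖(s θ : ℂ)‖ ≤ 1 := fun θ => by simpa using hs1 θ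
  have h1 := (Complex.abs_re_le_norm _).trans (norm_fejerSum_le hsm.aestronglyMeasurable hs2 N θ)
  have h2 := (Complex.abs_re_le_norm _).trans (norm_fourierCoeff_le hs2 0)
  rw [re_fejerSum] at h1
  have h3 : |(N : ℝ) * (fourierCoeff (fun θ => (s θ : ℂ)) 0).re| ≤ N := by
    rw [abs_mul, Nat.abs_cast]
    exact mul_le_of_le_one_right (Nat.cast_nonneg _) h2
  rw [abs_le] at h1 h3 ⊢
  constructor <;> linarith

theorem IsDerivation.exists_hasSymbol {D : DiscAlg →L[ℂ] StrongDual ℂ DiscAlg}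
    (hD : IsDerivation D) : ∃ h, MemHardyZero 1 h ∧ HasSymbol D h := by
  set ψ : ℂ[X] →ₗ[ℂ] ℂ :=
    { toFun := fun p => D (ofPoly p) 1
      map_add' := fun p q => by rw [ofPoly_add, map_add]; rfl
      map_smul' := fun c p => by
        rw [ofPoly, map_smul, map_smul]; rfl } with hψ
  have hψm : ∀ (m : ℕ) (c : ℂ), ψ (monomial m c) = c * ψ (X ^ m) := fun m c => by
    rw [← C_mul_X_pow_eq_monomial, ← smul_eq_C_mul, map_smul, smul_eq_mul]
  have h2π : (2 * π : ℂ) ≠ 0 := by simp [Real.pi_ne_zero]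
  -- The conjugate is there because the symbol enters the form conjugated, and `2π` because Fourier
  -- coefficients use normalised Haar measure while the form uses arc length.
  obtain ⟨a, b, ha, hb, hab⟩ := exists_mul_of_cesaro_bound
    (c := fun m => conj (ψ (X ^ m)) / (2 * π))
    (M := ‖D‖ * Real.exp 1 * Real.exp 1 / (2 * π)) fun s hs hs1 N => by
      have h1 : ∑ j ∈ Finset.range N, ∑ m ∈ Finset.range (j + 1), conj (ψ (X ^ m)) / (2 * π) *
          conj (fourierCoeff (fun θ => (s θ : ℂ)) (m : ℤ)) =
          conj (ψ (analyticFejer (fun θ => (s θ : ℂ)) N)) / (2 * π) := by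
        rw [analyticFejer, map_sum, map_sum, Finset.sum_div]
        refine Finset.sum_congr rfl fun j _ => ?_
        rw [map_sum, map_sum, Finset.sum_div]
        refine Finset.sum_congr rfl fun m _ => ?_
        rw [hψm, map_mul]
        ring
      rw [h1, norm_div, RCLike.norm_conj, div_mul_eq_mul_div]
      have h3 : ‖(2 * π : ℂ)‖ = 2 * π := by simp [abs_of_pos Real.pi_pos]
      rw [h3]
      refine div_le_div_of_nonneg_right ?_ Real.two_pi_pos.le
      rcases Nat.eq_zero_or_pos N with rfl | hN
      · simp [analyticFejer]
      have hN' : (0 : ℝ) < N := by exact_mod_cast hN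
      set F := analyticFejer (fun θ => (s θ : ℂ)) N
      -- The exponential bound is not homogeneous, so the Fejér sum is first divided by `N` to bring
      -- its real part below one.
      have h4 := hD.norm_apply_one_le (C := 1) (ofPoly (C ((N : ℂ)⁻¹) * F)) fun θ => by
        have h5 := abs_re_analyticFejer_le hs hs1 N θ
        rw [ofPoly_trace, eval_mul, eval_C, ← Complex.ofReal_natCast, ← Complex.ofReal_inv,
          Complex.re_ofReal_mul, abs_mul, abs_of_pos (inv_pos.2 hN'), inv_mul_le_iff₀ hN', mul_one]
        exact h5
      have h6 : ψ (C ((N : ℂ)⁻¹) * F) = (N : ℂ)⁻¹ * ψ F := by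
        rw [← smul_eq_C_mul, map_smul, smul_eq_mul]
      change ‖ψ (C ((N : ℂ)⁻¹) * F)‖ ≤ _ at h4
      rw [h6, norm_mul, norm_inv, Complex.norm_natCast, inv_mul_le_iff₀ hN'] at h4
      linarith
  have hmem := ha.mul hb
  refine ⟨fun θ => a θ * b θ, ⟨hmem, ?_⟩, fun f g => ?_⟩
  · rw [integral_eq_fourierCoeff_zero]
    have h0 := hab 0
    rw [Nat.cast_zero] at h0
    rw [h0, pow_zero]
    have : ψ 1 = 0 := by
      change D (ofPoly 1) 1 = 0
      rw [ofPoly_one, hD.map_one]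
    rw [this]
    simp
  · rw [hD.map_ofPoly_ofPoly, derivForm, integral_eq_haar,
      integral_eval_mul_conj hmem.integrable_haar]
    set u := primitive (derivative f * g)
    change ψ u = _
    rw [Polynomial.sum, Finset.mul_sum]
    conv_lhs => rw [← u.sum_monomial_eq, Polynomial.sum, map_sum]
    refine Finset.sum_congr rfl fun m _ => ?_
    rw [hψm, hab, map_div₀, Complex.conj_conj, map_mul, Complex.conj_ofReal, Complex.conj_ofNat]
    field_simp

/-! ### The logarithmic measure -/

theorem measurableSet_punctured : MeasurableSet {z : ℂ | 0 < ‖z‖ ∧ ‖z‖ < 1} :=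
  (measurableSet_lt measurable_const measurable_norm).inter
    (measurableSet_lt measurable_norm measurable_const)

theorem measurableSet_punctured_disc : MeasurableSet {z : Disc | 0 < ‖(z : ℂ)‖ ∧ ‖(z : ℂ)‖ < 1} :=
  measurable_subtype_coe measurableSet_punctured

theorem measurable_logWeight :
    Measurable fun z : Disc => ENNReal.ofReal (4 * Real.log (1 / ‖(z : ℂ)‖)) := by
  have : Measurable fun z : Disc => ‖(z : ℂ)‖ := measurable_norm.comp measurable_subtype_coe
  fun_prop

theorem ae_logMeasure_norm_lt_one : ∀ᵐ z : Disc ∂logMeasure, ‖(z : ℂ)‖ < 1 := by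
  refine (withDensity_absolutelyContinuous _ _).ae_le ?_
  filter_upwards [ae_restrict_mem measurableSet_punctured_disc] with z hz
  exact hz.2

theorem lintegral_restrict_punctured (F : ℂ → ℝ≥0∞) :
    ∫⁻ z : Disc in {z | 0 < ‖(z : ℂ)‖ ∧ ‖(z : ℂ)‖ < 1}, F z ∂((volume : Measure ℂ).comap Subtype.val) =
      ∫⁻ z, {z : ℂ | 0 < ‖z‖ ∧ ‖z‖ < 1}.indicator F z := by
  rw [← lintegral_indicator measurableSet_punctured_disc,
    show ({z : Disc | 0 < ‖(z : ℂ)‖ ∧ ‖(z : ℂ)‖ < 1}.indicator fun z : Disc => F z) =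
      fun z : Disc => {z : ℂ | 0 < ‖z‖ ∧ ‖z‖ < 1}.indicator F z from rfl,
    lintegral_subtype_comap Metric.isClosed_closedBall.measurableSet,
    lintegral_indicator measurableSet_punctured, lintegral_indicator measurableSet_punctured,
    Measure.restrict_restrict measurableSet_punctured, Set.inter_eq_left.2]
  exact fun z hz => mem_closedBall_zero_iff.2 hz.2.le

theorem integral_restrict_punctured (F : ℂ → ℂ) :
    ∫ z : Disc in {z | 0 < ‖(z : ℂ)‖ ∧ ‖(z : ℂ)‖ < 1}, F z ∂((volume : Measure ℂ).comap Subtype.val) =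
      ∫ z, {z : ℂ | 0 < ‖z‖ ∧ ‖z‖ < 1}.indicator F z := by
  rw [← integral_indicator measurableSet_punctured_disc,
    show ({z : Disc | 0 < ‖(z : ℂ)‖ ∧ ‖(z : ℂ)‖ < 1}.indicator fun z : Disc => F z) =
      fun z : Disc => {z : ℂ | 0 < ‖z‖ ∧ ‖z‖ < 1}.indicator F z from rfl,
    integral_subtype_comap Metric.isClosed_closedBall.measurableSet,
    integral_indicator measurableSet_punctured, integral_indicator measurableSet_punctured,
    Measure.restrict_restrict measurableSet_punctured, Set.inter_eq_left.2]
  exact fun z hz => mem_closedBall_zero_iff.2 hz.2.le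

/-- In polar coordinates the density is `4 r log (1 / r) ≤ 4 (1 - r) ≤ 4`, by `log x ≤ x - 1` at `x
= 1 / r`. -/
instance isFiniteMeasure_logMeasure : IsFiniteMeasure logMeasure := by
  refine isFiniteMeasure_withDensity ?_
  rw [lintegral_restrict_punctured fun z => ENNReal.ofReal (4 * Real.log (1 / ‖z‖)),
    ← Complex.lintegral_comp_polarCoord_symm, polarCoord_target]
  refine ne_of_lt (lt_of_le_of_lt (setLIntegral_mono (g := (Set.Iio 1 ×ˢ Set.univ).indicator
    fun _ => 4) (measurable_const.indicator (measurableSet_Iio.prod MeasurableSet.univ))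
    fun p hp => ?_) ?_)
  · have hr : 0 < p.1 := hp.1
    by_cases hp1 : p.1 < 1
    · rw [Set.indicator_of_mem (show p ∈ Set.Iio 1 ×ˢ Set.univ from ⟨hp1, trivial⟩),
        Set.indicator_of_mem, Complex.norm_polarCoord_symm, abs_of_pos hr, smul_eq_mul,
        ← ENNReal.ofReal_mul hr.le, ← ENNReal.ofReal_ofNat]
      · refine ENNReal.ofReal_le_ofReal ?_
        have h1 := Real.log_le_sub_one_of_pos (one_div_pos.2 hr)
        have h2 : p.1 * (1 / p.1) = 1 := by field_simp
        nlinarith [mul_le_mul_of_nonneg_left h1 hr.le]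
      · rw [Set.mem_ofPred_eq, Complex.norm_polarCoord_symm, abs_of_pos hr]
        exact ⟨hr, hp1⟩
    · rw [Set.indicator_of_notMem (s := {z : ℂ | 0 < ‖z‖ ∧ ‖z‖ < 1})]
      · simp
      · rw [Set.mem_ofPred_eq, Complex.norm_polarCoord_symm, abs_of_pos hr]
        exact fun h => hp1 h.2
  · rw [lintegral_indicator (measurableSet_Iio.prod MeasurableSet.univ), setLIntegral_const,
      Measure.restrict_apply (measurableSet_Iio.prod MeasurableSet.univ), Set.prod_inter_prod,
      Measure.volume_eq_prod, Measure.prod_prod, Set.Iio_inter_Ioi, Set.univ_inter,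
      Real.volume_Ioo, Real.volume_Ioo]
    finiteness

theorem integral_logMeasure (F : ℂ → ℂ) :
    ∫ z, F z ∂logMeasure = ∫ p in Set.Ioi (0 : ℝ) ×ˢ Set.Ioo (-π) π,
      p.1 • (if p.1 < 1 then ((4 * Real.log (1 / p.1) : ℝ) : ℂ) *
        F (p.1 * Complex.exp (p.2 * Complex.I)) else 0) := by
  rw [logMeasure, integral_withDensity_eq_integral_toReal_smul measurable_logWeight
    (ae_of_all _ fun _ => ENNReal.ofReal_lt_top),
    integral_restrict_punctured fun z => (ENNReal.ofReal (4 * Real.log (1 / ‖z‖))).toReal • F z,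
    ← Complex.integral_comp_polarCoord_symm, polarCoord_target]
  refine setIntegral_congr_fun (measurableSet_Ioi.prod measurableSet_Ioo) fun p hp => ?_
  have hr : 0 < p.1 := hp.1
  have hpol : Complex.polarCoord.symm p = p.1 * Complex.exp (p.2 * Complex.I) := by
    rw [Complex.polarCoord_symm_apply, Complex.exp_mul_I]
    push_cast
    rfl
  have hn : ‖Complex.polarCoord.symm p‖ = p.1 := by
    rw [Complex.norm_polarCoord_symm, abs_of_pos hr]
  congr 1
  split_ifs with hp1
  · rw [Set.indicator_of_mem, hn, hpol, ENNReal.toReal_ofReal, Complex.real_smul]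
    · have := Real.log_nonneg (one_le_one_div hr hp1.le)
      positivity
    · rw [Set.mem_ofPred_eq, hn]
      exact ⟨hr, hp1⟩
  · rw [Set.indicator_of_notMem]
    rw [Set.mem_ofPred_eq, hn]
    exact fun h => hp1 h.2

theorem integral_pow_mul_log (n : ℕ) :
    ∫ r in (0 : ℝ)..1, r ^ (2 * n) * (r * Real.log r) = -(1 / (4 * ((n : ℝ) + 1) ^ 2)) := by
  have hn : (n : ℝ) + 1 ≠ 0 := by positivity
  -- The primitive from integration by parts, with `r log r` kept together so that it is continuous
  -- at the endpoint 0.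
  have h := intervalIntegral.integral_eq_sub_of_hasDerivAt_of_le (a := 0) (b := 1)
    (f := fun r => r ^ (2 * n + 1) * (r * Real.log r) / (2 * (n + 1)) -
      r ^ (2 * n + 2) / (4 * ((n : ℝ) + 1) ^ 2))
    (f' := fun r => r ^ (2 * n) * (r * Real.log r)) zero_le_one ?_ ?_ ?_
  · rw [h]
    simp
  · have := Real.continuous_mul_log
    exact Continuous.continuousOn (by fun_prop)
  · intro r hr
    have hr0 : r ≠ 0 := hr.1.ne'
    have h1 := (((hasDerivAt_pow (2 * n + 2) r).mul (Real.hasDerivAt_log hr0)).div_const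
      (2 * ((n : ℝ) + 1))).sub ((hasDerivAt_pow (2 * n + 2) r).div_const (4 * ((n : ℝ) + 1) ^ 2))
    convert h1 using 1
    · ext x
      simp only [Pi.mul_apply, Pi.sub_apply]
      ring
    · simp only [show 2 * n + 2 - 1 = 2 * n + 1 by omega]
      push_cast
      field_simp
      ring
  · have := Real.continuous_mul_log
    exact Continuous.intervalIntegrable (by fun_prop) _ _

theorem integral_exp_int (k : ℤ) :
    ∫ θ in Set.Ioo (-π) π, Complex.exp (k * (θ * Complex.I)) = if k = 0 then (2 * π : ℂ) else 0 := by
  have hle : -π ≤ π := by linarith [Real.pi_pos]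
  rw [← integral_Ioc_eq_integral_Ioo, ← intervalIntegral.integral_of_le hle]
  split_ifs with hk
  · subst hk
    simp
    ring
  · have hc : (k : ℂ) * Complex.I ≠ 0 := mul_ne_zero (by exact_mod_cast hk) Complex.I_ne_zero
    have : ∀ θ : ℝ, Complex.exp (k * (θ * Complex.I)) = Complex.exp ((k * Complex.I) * θ) :=
      fun θ => by ring_nf
    simp only [this]
    rw [integral_exp_mul_complex hc]
    have h2 : Complex.exp (k * Complex.I * (π : ℝ)) = Complex.exp (k * Complex.I * ((-π : ℝ))) := by
      rw [Complex.exp_eq_exp_iff_exists_int]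
      exact ⟨k, by push_cast; ring⟩
    rw [h2, sub_self, zero_div]

/-- The angular integral kills `m ≠ n`; on the diagonal, `2π` times four times the radial integral
`1 / (4 (n + 1)²)` remains. -/
theorem integral_logMeasure_monomial (m n : ℕ) :
    ∫ z : Disc, (z : ℂ) ^ m * conj (z : ℂ) ^ n ∂logMeasure =
      if m = n then 2 * π / ((n : ℂ) + 1) ^ 2 else 0 := by
  rw [integral_logMeasure fun z => z ^ m * conj z ^ n]
  have h1 : ∀ p : ℝ × ℝ, p.1 • (if p.1 < 1 then ((4 * Real.log (1 / p.1) : ℝ) : ℂ) *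
      ((p.1 * Complex.exp (p.2 * Complex.I)) ^ m * conj (p.1 * Complex.exp (p.2 * Complex.I)) ^ n)
      else 0) = (((Set.Iio (1 : ℝ)).indicator
        (fun r => -4 * (r ^ (m + n) * (r * Real.log r))) p.1 : ℝ) : ℂ) *
      Complex.exp (((m : ℤ) - n : ℤ) * (p.2 * Complex.I)) := fun p => by
    by_cases hp : p.1 < 1
    · rw [if_pos hp, Set.indicator_of_mem (show p.1 ∈ Set.Iio 1 from hp), map_mul,
        ← Complex.exp_conj, map_mul, Complex.conj_ofReal, Complex.conj_ofReal, Complex.conj_I,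
        mul_pow, mul_pow, ← Complex.exp_nat_mul, ← Complex.exp_nat_mul, Complex.real_smul, one_div,
        Real.log_inv]
      have : Complex.exp (((m : ℤ) - n : ℤ) * (p.2 * Complex.I)) =
          Complex.exp (m * (p.2 * Complex.I)) * Complex.exp (n * (p.2 * -Complex.I)) := by
        rw [← Complex.exp_add]
        push_cast
        ring_nf
      rw [this]
      push_cast
      ring
    · rw [if_neg hp, Set.indicator_of_notMem (show p.1 ∉ Set.Iio 1 from hp)]
      simp
  simp only [h1]
  rw [Measure.volume_eq_prod, setIntegral_prod_mul (fun r : ℝ => (((Set.Iio (1 : ℝ)).indicator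
        (fun r => -4 * (r ^ (m + n) * (r * Real.log r))) r : ℝ) : ℂ))
        (fun θ : ℝ => Complex.exp (((m : ℤ) - n : ℤ) * (θ * Complex.I))), integral_exp_int]
  by_cases hmn : m = n
  · subst hmn
    rw [integral_complex_ofReal, setIntegral_indicator measurableSet_Iio, Set.Ioi_inter_Iio,
      ← integral_Ioc_eq_integral_Ioo, ← intervalIntegral.integral_of_le zero_le_one,
      intervalIntegral.integral_const_mul, ← two_mul, integral_pow_mul_log]
    have : (m : ℂ) + 1 ≠ 0 := Nat.cast_add_one_ne_zero m
    simp
    field_simp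
  · rw [if_neg (by omega), mul_zero, if_neg hmn]

theorem memLp_disc {F : Disc → ℂ} (hF : Continuous F) (p : ℝ≥0∞) (μ : Measure Disc)
    [IsFiniteMeasure μ] : MemLp F p μ :=
  MemLp.of_bound hF.aestronglyMeasurable ‖(⟨F, hF⟩ : C(Disc, ℂ))‖
    (ae_of_all _ fun z => (⟨F, hF⟩ : C(Disc, ℂ)).norm_coe_le_norm z)

theorem integrable_disc {F : Disc → ℂ} (hF : Continuous F) (μ : Measure Disc)
    [IsFiniteMeasure μ] : Integrable F μ :=
  memLp_one_iff_integrable.1 (memLp_disc hF 1 μ)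

theorem continuous_eval_disc (p : ℂ[X]) : Continuous fun z : Disc => p.eval (z : ℂ) :=
  p.continuous.comp continuous_subtype_val

theorem integrable_eval_mul_conj_eval (p q : ℂ[X]) :
    Integrable (fun θ : Torus => p.eval (toCircle θ : ℂ) * conj (q.eval (toCircle θ : ℂ)))
      volume := by
  have := continuous_eval_toCircle p
  have := continuous_eval_toCircle q
  exact memLp_one_iff_integrable.1 (memLp_of_continuous (by fun_prop) _ _)

theorem integrable_disc_eval_mul_conj_eval (p q : ℂ[X]) :
    Integrable (fun z : Disc => p.eval (z : ℂ) * conj (q.eval (z : ℂ))) logMeasure := by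
  have := continuous_eval_disc p
  have := continuous_eval_disc q
  exact integrable_disc (by fun_prop) _

/-- The Littlewood–Paley identity for polynomials. -/
theorem integral_mul_conj_eq (p q : ℂ[X]) :
    ∫ θ : Torus, p.eval (toCircle θ : ℂ) * conj (q.eval (toCircle θ : ℂ)) =
      2 * π * (p.eval 0 * conj (q.eval 0)) +
        ∫ z : Disc, (derivative p).eval (z : ℂ) * conj ((derivative q).eval (z : ℂ))
          ∂logMeasure := by
  induction p using Polynomial.induction_on' with
  | add p p' hp hp' =>
    simp only [eval_add, derivative_add, add_mul]
    rw [integral_add (integrable_eval_mul_conj_eval _ _) (integrable_eval_mul_conj_eval _ _),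
      integral_add (integrable_disc_eval_mul_conj_eval _ _)
        (integrable_disc_eval_mul_conj_eval _ _), hp, hp']
    ring
  | monomial m a =>
    induction q using Polynomial.induction_on' with
    | add q q' hq hq' =>
      simp only [eval_add, map_add, mul_add]
      rw [integral_add (integrable_eval_mul_conj_eval _ _) (integrable_eval_mul_conj_eval _ _),
        integral_add (integrable_disc_eval_mul_conj_eval _ _)
          (integrable_disc_eval_mul_conj_eval _ _), hq, hq']
      ring
    | monomial n b =>
      have h1 : ∫ θ : Torus, (monomial m a).eval (toCircle θ : ℂ) *
          conj ((monomial n b).eval (toCircle θ : ℂ)) =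
          2 * π * (a * conj b * if m = n then 1 else 0) := by
        have h2 : ∀ θ : Torus, (monomial m a).eval (toCircle θ : ℂ) *
            conj ((monomial n b).eval (toCircle θ : ℂ)) =
            (a * conj b) * fourier ((m : ℤ) + -n) θ := fun θ => by
          rw [eval_monomial, eval_monomial, ← fourier_natCast, ← fourier_natCast, map_mul,
            ← fourier_neg, fourier_add]
          ring
        simp only [h2]
        rw [integral_eq_haar, integral_const_mul, integral_fourier]
        congr 3
        simp only [eq_iff_iff]
        omega
      have h3 : ∫ z : Disc, (derivative (monomial m a)).eval (z : ℂ) *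
          conj ((derivative (monomial n b)).eval (z : ℂ)) ∂logMeasure =
          (a * m * conj (b * n)) * if m - 1 = n - 1 then 2 * π / (((n - 1 : ℕ) : ℂ) + 1) ^ 2
            else 0 := by
        rw [← integral_logMeasure_monomial, ← integral_const_mul]
        refine integral_congr_ae (ae_of_all _ fun z => ?_)
        simp only [derivative_monomial, eval_monomial, map_mul, map_pow]
        ring
      rw [h1, h3]
      -- When `m` or `n` is 0 the truncated exponent is harmless, since the derivative contributes a
      -- factor 0. Otherwise the factors `m n` from the derivatives cancel the denominator.
      rcases m with _ | m <;> rcases n with _ | n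
      · simp
      · simp
      · simp
      · simp only [Nat.add_sub_cancel, eval_monomial, Nat.add_right_cancel_iff]
        split_ifs with hmn
        · subst hmn
          have : (m : ℂ) + 1 ≠ 0 := Nat.cast_add_one_ne_zero m
          simp only [map_mul, Complex.conj_natCast]
          push_cast
          field_simp
          simp
        · simp

/-! ### Square norms -/

section TwoNorm

variable {α : Type*} [MeasurableSpace α] {μ : Measure α} {F G : α → ℂ}

/-- The `L²` norm as a real number. -/
noncomputable def twoNorm (μ : Measure α) (F : α → ℂ) : ℝ := (eLpNorm F 2 μ).toReal

theorem twoNorm_nonneg : 0 ≤ twoNorm μ F := ENNReal.toReal_nonneg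

theorem eLpNorm_two_eq (hF : MemLp F 2 μ) :
    eLpNorm F 2 μ = ENNReal.ofReal √(∫ x, ‖F x‖ ^ 2 ∂μ) := by
  rw [hF.eLpNorm_eq_integral_rpow_norm two_ne_zero ENNReal.ofNat_ne_top, Real.sqrt_eq_rpow]
  simp

theorem twoNorm_eq_sqrt (hF : MemLp F 2 μ) : twoNorm μ F = √(∫ x, ‖F x‖ ^ 2 ∂μ) := by
  rw [twoNorm, eLpNorm_two_eq hF, ENNReal.toReal_ofReal (Real.sqrt_nonneg _)]

theorem twoNorm_add_le (hF : MemLp F 2 μ) (hG : MemLp G 2 μ) :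
    twoNorm μ (fun x => F x + G x) ≤ twoNorm μ F + twoNorm μ G := by
  rw [twoNorm, twoNorm, twoNorm, ← ENNReal.toReal_add hF.2.ne hG.2.ne]
  exact ENNReal.toReal_mono (ENNReal.add_ne_top.2 ⟨hF.2.ne, hG.2.ne⟩)
    (eLpNorm_add_le hF.1 hG.1 (by norm_num))

theorem twoNorm_le_mul (hG : MemLp G 2 μ) {c : ℝ} (hc : 0 ≤ c)
    (h : ∀ᵐ x ∂μ, ‖F x‖ ≤ c * ‖G x‖) : twoNorm μ F ≤ c * twoNorm μ G := by
  have h1 := eLpNorm_le_mul_eLpNorm_of_ae_le_mul h 2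
  rw [twoNorm, twoNorm, ← ENNReal.toReal_ofReal hc, ← ENNReal.toReal_mul]
  exact ENNReal.toReal_mono (ENNReal.mul_ne_top ENNReal.ofReal_ne_top hG.2.ne) h1

theorem norm_integral_mul_le (hF : MemLp F 2 μ) (hG : MemLp G 2 μ) :
    ‖∫ x, F x * G x ∂μ‖ ≤ twoNorm μ F * twoNorm μ G := by
  have h1 : ‖∫ x, F x * G x ∂μ‖ₑ ≤ eLpNorm F 2 μ * eLpNorm G 2 μ := by
    refine (enorm_integral_le_lintegral_enorm _).trans ?_
    rw [← eLpNorm_one_eq_lintegral_enorm]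
    have h3 := eLpNorm_smul_le_mul_eLpNorm (p := 2) (q := 2) (r := 1) hG.1 hF.1
    exact h3
  have h2 := ENNReal.toReal_mono (ENNReal.mul_ne_top hF.2.ne hG.2.ne) h1
  rwa [ENNReal.toReal_mul, toReal_enorm] at h2

end TwoNorm

/-! ### The estimate for polynomial symbols -/

theorem eLpNorm_derivative_eq {p : ℂ[X]} (hp : p.eval 0 = 0) :
    eLpNorm (fun z : Disc => (derivative p).eval (z : ℂ)) 2 logMeasure =
      eLpNorm (fun θ : Torus => p.eval (toCircle θ : ℂ)) 2 volume := by
  have h := integral_mul_conj_eq p p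
  simp only [hp, zero_mul, mul_zero, zero_add, Complex.mul_conj', ← Complex.ofReal_pow] at h
  rw [integral_complex_ofReal, integral_complex_ofReal] at h
  rw [eLpNorm_two_eq (memLp_disc (continuous_eval_disc _) _ _),
    eLpNorm_two_eq (memLp_of_continuous (continuous_eval_toCircle p) _ _), Complex.ofReal_injective h]

/-- Littlewood–Paley for `u` and `p²`, with `u(0) = 0`, `u' = f' g` and `(p²)' = 2 p p'`, followed
by Cauchy–Schwarz. -/
theorem norm_derivForm_sq_eval_le (f g p : ℂ[X]) (hp : p.eval 0 = 0) :
    ‖derivForm (fun θ => p.eval (toCircle θ : ℂ) ^ 2) f g‖ ≤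
      2 * ‖ofPoly g‖ * ((twoNorm volume fun θ : Torus => p.eval (toCircle θ : ℂ)) *
        ((twoNorm volume fun θ : Torus => f.eval (toCircle θ : ℂ) * p.eval (toCircle θ : ℂ)) +
          twoNorm logMeasure fun z : Disc => f.eval (z : ℂ) * (derivative p).eval (z : ℂ))) := by
  have hfc := continuous_eval_disc f
  have hfc' := continuous_eval_disc (derivative f)
  have hgc := continuous_eval_disc g
  have hpc := continuous_eval_disc p
  have hpc' := continuous_eval_disc (derivative p)
  have h1 : derivForm (fun θ => p.eval (toCircle θ : ℂ) ^ 2) f g = ∫ z : Disc,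
      (2 * g.eval (z : ℂ) * ((derivative f).eval (z : ℂ) * conj (p.eval (z : ℂ)))) *
        conj ((derivative p).eval (z : ℂ)) ∂logMeasure := by
    have := integral_mul_conj_eq (primitive (derivative f * g)) (p ^ 2)
    rw [derivForm]
    simp only [eval_pow] at this
    rw [this, eval_zero_primitive, derivative_primitive, zero_mul, mul_zero, zero_add]
    refine integral_congr_ae (ae_of_all _ fun z => ?_)
    simp only [sq, eval_mul, derivative_mul, eval_add, map_mul, map_add]
    ring
  have h2 : (twoNorm logMeasure fun z : Disc => (derivative f).eval (z : ℂ) * p.eval (z : ℂ)) ≤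
      (twoNorm volume fun θ : Torus => f.eval (toCircle θ : ℂ) * p.eval (toCircle θ : ℂ)) +
          twoNorm logMeasure fun z : Disc => f.eval (z : ℂ) * (derivative p).eval (z : ℂ) := by
    -- `f' p = (f p)' - f p'`; the norm of `(f p)'` is moved to the circle because `f p` vanishes at
    -- 0.
    have h3 : (fun z : Disc => (derivative f).eval (z : ℂ) * p.eval (z : ℂ)) = fun z : Disc =>
        (derivative (f * p)).eval (z : ℂ) + -(f.eval (z : ℂ) * (derivative p).eval (z : ℂ)) := by
      funext z
      rw [derivative_mul, eval_add, eval_mul, eval_mul]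
      ring
    have h4 : (twoNorm logMeasure fun z : Disc => -(f.eval (z : ℂ) * (derivative p).eval (z : ℂ))) ≤
        twoNorm logMeasure fun z : Disc => f.eval (z : ℂ) * (derivative p).eval (z : ℂ) := by
      refine (twoNorm_le_mul (memLp_disc (by fun_prop) _ _) zero_le_one
        (ae_of_all _ fun z => ?_)).trans_eq (one_mul _)
      rw [norm_neg, one_mul]
    rw [h3]
    refine (twoNorm_add_le (memLp_disc (continuous_eval_disc _) _ _)
      (memLp_disc (by fun_prop) _ _)).trans (add_le_add (le_of_eq ?_) h4)
    rw [twoNorm, eLpNorm_derivative_eq (by rw [eval_mul, hp, mul_zero]), twoNorm]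
    simp only [eval_mul]
  rw [h1]
  refine (norm_integral_mul_le (memLp_disc (by fun_prop) _ _)
    (memLp_disc (by fun_prop) _ _)).trans ?_
  have h5 : (twoNorm logMeasure fun z : Disc => 2 * g.eval (z : ℂ) *
      ((derivative f).eval (z : ℂ) * conj (p.eval (z : ℂ)))) ≤ 2 * ‖ofPoly g‖ *
      twoNorm logMeasure fun z : Disc => (derivative f).eval (z : ℂ) * p.eval (z : ℂ) := by
    refine twoNorm_le_mul (memLp_disc (by fun_prop) _ _) (by positivity) (ae_of_all _ fun z => ?_)
    rw [norm_mul, norm_mul, norm_mul, norm_mul, RCLike.norm_conj, Complex.norm_ofNat, ← ofPoly_apply]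
    have := (ofPoly g).norm_apply_le z
    gcongr
  have h6 : (twoNorm logMeasure fun z : Disc => conj ((derivative p).eval (z : ℂ))) ≤
      twoNorm volume fun θ : Torus => p.eval (toCircle θ : ℂ) := by
    rw [twoNorm, twoNorm, ← eLpNorm_derivative_eq hp]
    refine (twoNorm_le_mul (G := fun z : Disc => (derivative p).eval (z : ℂ))
      (memLp_disc (by fun_prop) _ _) zero_le_one
      (ae_of_all _ fun z => ?_)).trans_eq (one_mul _)
    rw [RCLike.norm_conj, one_mul]
  calc _ ≤ (2 * ‖ofPoly g‖ * _) * _ := mul_le_mul (h5.trans (mul_le_mul_of_nonneg_left h2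
        (by positivity))) h6 twoNorm_nonneg (mul_nonneg (by positivity)
        (add_nonneg twoNorm_nonneg twoNorm_nonneg))
    _ = _ := by ring

/-! ### Partial sums of the Taylor series -/

/-- The partial sums of the Taylor series of a function in a Hardy space. -/
noncomputable def taylorPoly (k : Torus → ℂ) (N : ℕ) : ℂ[X] :=
  ∑ n ∈ Finset.range N, monomial n (fourierCoeff k (n : ℤ))

theorem taylorPoly_coeff (k : Torus → ℂ) (N n : ℕ) :
    (taylorPoly k N).coeff n = if n < N then fourierCoeff k (n : ℤ) else 0 := by
  simp [taylorPoly, finsetSum_coeff, coeff_monomial]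

theorem memHardy_eval (p : ℂ[X]) (r : ℝ≥0∞) :
    MemHardy r fun θ : Torus => p.eval (toCircle θ : ℂ) := by
  have := memHardy_trace (ofPoly p) r
  rwa [show (ofPoly p).trace = _ from funext (ofPoly_trace p)] at this

theorem eLpNorm_two_volume_eq {f : Torus → ℂ} (hf : MemLp f 2 volume) :
    eLpNorm f 2 volume = ENNReal.ofReal √(2 * π * ∫ θ, ‖f θ‖ ^ 2 ∂haarAddCircle) := by
  rw [eLpNorm_two_eq hf, integral_eq_haar_real]

variable {k : Torus → ℂ}

theorem MemHardy.hasSum_sq (hk : MemHardy 2 k) :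
    HasSum (fun n : ℕ => ‖fourierCoeff k (n : ℤ)‖ ^ 2) (∫ θ, ‖k θ‖ ^ 2 ∂haarAddCircle) := by
  have h := hasSum_sq_fourierCoeff_of_memLp hk.memLp_haar
  refine (Function.Injective.hasSum_iff (g := fun n : ℕ => (n : ℤ)) Nat.cast_injective
    fun i hi => ?_).2 h
  rw [hk.2 i, norm_zero, zero_pow two_ne_zero]
  by_contra hi'
  exact hi ⟨i.toNat, by simp; omega⟩

theorem MemHardy.sub_taylorPoly (hk : MemHardy 2 k) (N : ℕ) :
    MemHardy 2 fun θ => k θ - (taylorPoly k N).eval (toCircle θ : ℂ) := by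
  have := hk.linearCombination (by norm_num) (memHardy_eval (taylorPoly k N) 2) 1 (-1)
  simpa only [one_mul, neg_mul, ← sub_eq_add_neg] using this

theorem MemHardy.tendsto_taylorPoly (hk : MemHardy 2 k) :
    Tendsto (fun N => eLpNorm (fun θ => k θ - (taylorPoly k N).eval (toCircle θ : ℂ)) 2 volume)
      atTop (𝓝 0) := by
  have h1 : ∀ N, ∫ θ : Torus, ‖k θ - (taylorPoly k N).eval (toCircle θ : ℂ)‖ ^ 2 ∂haarAddCircle =
      ∫ θ, ‖k θ‖ ^ 2 ∂haarAddCircle - ∑ n ∈ Finset.range N, ‖fourierCoeff k (n : ℤ)‖ ^ 2 := fun N => by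
    refine (hk.sub_taylorPoly N).hasSum_sq.unique ?_
    have h2 : HasSum (fun n : ℕ => if n < N then ‖fourierCoeff k (n : ℤ)‖ ^ 2 else 0)
        (∑ n ∈ Finset.range N, ‖fourierCoeff k (n : ℤ)‖ ^ 2) := by
      rw [← Finset.sum_congr rfl (g := fun n : ℕ => ‖fourierCoeff k (n : ℤ)‖ ^ 2)
        (fun n hn => if_pos (Finset.mem_range.1 hn))]
      exact hasSum_sum_of_ne_finset_zero fun n hn => if_neg fun h => hn (Finset.mem_range.2 h)
    have h4 : (fun n : ℕ => ‖fourierCoeff (fun θ => k θ - (taylorPoly k N).eval (toCircle θ : ℂ))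
        (n : ℤ)‖ ^ 2) = fun n : ℕ => ‖fourierCoeff k (n : ℤ)‖ ^ 2 -
          if n < N then ‖fourierCoeff k (n : ℤ)‖ ^ 2 else 0 := ?_
    · rw [h4]
      exact hk.hasSum_sq.sub h2
    funext n
    have h3 : fourierCoeff (fun θ => k θ - (taylorPoly k N).eval (toCircle θ : ℂ)) (n : ℤ) =
        fourierCoeff k (n : ℤ) - (taylorPoly k N).coeff n := by
      rw [← fourierCoeff_eval]
      have := integral_sub ((hk.memLp_haar.integrable (by norm_num)).fourier_smul (-(n : ℤ)))
        ((memHardy_eval (taylorPoly k N) 1).integrable_haar.fourier_smul (-(n : ℤ)))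
      simp only [← smul_sub] at this
      exact this
    rw [h3, taylorPoly_coeff]
    split_ifs <;> simp
  have h2 : Tendsto (fun N => ∫ θ, ‖k θ‖ ^ 2 ∂haarAddCircle -
      ∑ n ∈ Finset.range N, ‖fourierCoeff k (n : ℤ)‖ ^ 2) atTop (𝓝 0) := by
    have := hk.hasSum_sq.tendsto_sum_nat.const_sub (∫ θ, ‖k θ‖ ^ 2 ∂haarAddCircle)
    rwa [sub_self] at this
  have h3 := (ENNReal.tendsto_ofReal ((h2.const_mul (2 * π)).sqrt))
  rw [mul_zero, Real.sqrt_zero, ENNReal.ofReal_zero] at h3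
  refine h3.congr fun N => ?_
  rw [eLpNorm_two_volume_eq (hk.sub_taylorPoly N).1, h1]

/-- The coefficients are bounded, so the series may be differentiated termwise on a ball of radius
`r` with `|z| < r < 1`. -/
theorem MemHardy.tendsto_derivative_taylorPoly (hk : MemHardy 2 k) {z : ℂ} (hz : ‖z‖ < 1) :
    Tendsto (fun N => (derivative (taylorPoly k N)).eval z) atTop (𝓝 (deriv (hardyExt k) z)) := by
  obtain ⟨r, hzr, hr1⟩ := exists_between hz
  have hr0 : 0 < r := (norm_nonneg z).trans_lt hzr
  set B := √(∫ θ, ‖k θ‖ ^ 2 ∂haarAddCircle)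
  have hB : ∀ n : ℕ, ‖fourierCoeff k (n : ℤ)‖ ≤ B := fun n =>
    Real.le_sqrt_of_sq_le (le_hasSum hk.hasSum_sq n fun _ _ => by positivity)
  have hu : Summable fun n : ℕ => B * (n * r ^ (n - 1)) := by
    refine Summable.mul_left _ ((summable_nat_add_iff 1).1 ?_)
    have h1 := (summable_pow_mul_geometric_of_norm_lt_one 1
      (show ‖r‖ < 1 by rwa [Real.norm_of_nonneg hr0.le])).add
      (summable_geometric_of_lt_one hr0.le hr1)
    refine h1.congr fun n => ?_
    simp only [Nat.add_sub_cancel]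
    push_cast
    ring
  have hb : ∀ (n : ℕ) (y : ℂ), y ∈ Metric.ball (0 : ℂ) r →
      ‖fourierCoeff k (n : ℤ) * (n * y ^ (n - 1))‖ ≤ B * (n * r ^ (n - 1)) := fun n y hy => by
    have : ‖y‖ ≤ r := (mem_ball_zero_iff.1 hy).le
    rw [norm_mul, norm_mul, norm_pow, Complex.norm_natCast]
    have := hB n
    gcongr
  have hzm : z ∈ Metric.ball (0 : ℂ) r := mem_ball_zero_iff.2 hzr
  have hd := hasDerivAt_tsum_of_isPreconnected hu Metric.isOpen_ball
    (convex_ball (0 : ℂ) r).isPreconnected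
    (g := fun (n : ℕ) y => fourierCoeff k (n : ℤ) * y ^ n) (y₀ := 0)
    (fun n y _ => (hasDerivAt_pow n y).const_mul _) hb (Metric.mem_ball_self hr0)
    (summable_of_ne_finset_zero (s := {0}) fun n hn => by
      simp at hn; simp [hn]) hzm
  have hs : Summable fun n : ℕ => fourierCoeff k (n : ℤ) * (n * z ^ (n - 1)) :=
    Summable.of_norm_bounded hu fun n => hb n z hzm
  rw [show deriv (hardyExt k) z = _ from hd.deriv]
  refine hs.hasSum.tendsto_sum_nat.congr fun N => ?_
  rw [taylorPoly, derivative_sum, eval_finsetSum]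
  refine Finset.sum_congr rfl fun n _ => ?_
  rw [derivative_monomial, eval_monomial]
  ring

theorem measurable_deriv_hardyExt (k : Torus → ℂ) :
    Measurable fun z : Disc => deriv (hardyExt k) (z : ℂ) :=
  (measurable_deriv _).comp measurable_subtype_coe

theorem MemHardyZero.eval_taylorPoly_zero {p : ℝ≥0∞} (hk : MemHardyZero p k) (N : ℕ) :
    (taylorPoly k N).eval 0 = 0 := by
  rw [← coeff_zero_eq_eval_zero, taylorPoly_coeff, Nat.cast_zero, hk.fourierCoeff_zero, ite_self]

theorem MemHardyZero.eLpNorm_deriv_sub_le (hk : MemHardyZero 2 k) (N : ℕ) :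
    eLpNorm (fun z : Disc => deriv (hardyExt k) (z : ℂ) - (derivative (taylorPoly k N)).eval (z : ℂ))
      2 logMeasure ≤
    eLpNorm (fun θ => k θ - (taylorPoly k N).eval (toCircle θ : ℂ)) 2 volume := by
  set e : ℕ → ℝ≥0∞ := fun N =>
    eLpNorm (fun θ => k θ - (taylorPoly k N).eval (toCircle θ : ℂ)) 2 volume
  -- Fatou along the Taylor polynomials of degree below `M`: for polynomials the two norms agree,
  -- and the triangle inequality bounds them by `e N + e M`, which tends to `e N`.
  have h1 := Lp.eLpNorm_lim_le_liminf_eLpNorm (p := 2) (μ := logMeasure)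
    (f := fun M (z : Disc) => (derivative (taylorPoly k M)).eval (z : ℂ) -
      (derivative (taylorPoly k N)).eval (z : ℂ))
    (fun M => ((continuous_eval_disc _).sub (continuous_eval_disc _)).aestronglyMeasurable)
    (fun z : Disc => deriv (hardyExt k) (z : ℂ) - (derivative (taylorPoly k N)).eval (z : ℂ)) (by
      filter_upwards [ae_logMeasure_norm_lt_one] with z hz
      exact (hk.1.tendsto_derivative_taylorPoly hz).sub_const _)
  refine h1.trans ?_
  have h2 : ∀ M, eLpNorm (fun z : Disc => (derivative (taylorPoly k M)).eval (z : ℂ) -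
      (derivative (taylorPoly k N)).eval (z : ℂ)) 2 logMeasure ≤ e N + e M := fun M => by
    have h3 := eLpNorm_derivative_eq (p := taylorPoly k M - taylorPoly k N) (by
      rw [eval_sub, hk.eval_taylorPoly_zero, hk.eval_taylorPoly_zero, sub_zero])
    simp only [derivative_sub, eval_sub] at h3
    rw [h3]
    refine (eLpNorm_congr_ae (ae_of_all _ fun θ => ?_)).trans_le
      (eLpNorm_sub_le (hk.1.sub_taylorPoly N).1.1 (hk.1.sub_taylorPoly M).1.1 (by norm_num))
    simp
  have h4 : Tendsto (fun M => e N + e M) atTop (𝓝 (e N)) := by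
    have := (tendsto_const_nhds (x := e N)).add hk.1.tendsto_taylorPoly
    rwa [add_zero] at this
  exact (liminf_le_liminf (Eventually.of_forall h2)).trans_eq h4.liminf_eq

theorem MemHardyZero.memLp_deriv (hk : MemHardyZero 2 k) :
    MemLp (fun z : Disc => deriv (hardyExt k) (z : ℂ)) 2 logMeasure := by
  -- For `N = 0` the Taylor polynomial is zero, so the comparison bounds `k'` itself.
  have h0 : MemLp (fun z : Disc => deriv (hardyExt k) (z : ℂ) -
      (derivative (taylorPoly k 0)).eval (z : ℂ)) 2 logMeasure :=
    ⟨((measurable_deriv_hardyExt k).sub (continuous_eval_disc _).measurable).aestronglyMeasurable,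
      (hk.eLpNorm_deriv_sub_le 0).trans_lt (hk.1.sub_taylorPoly 0).1.2⟩
  simpa [taylorPoly] using h0

/-! ### The estimate for squares of functions in `H²_0` -/

theorem derivForm_eq_sum {h : Torus → ℂ} (hh : Integrable h haarAddCircle) (f g : ℂ[X]) :
    derivForm h f g = 2 * π * (primitive (derivative f * g)).sum fun m c =>
      c * conj (fourierCoeff h m) := by
  rw [derivForm, integral_eq_haar, integral_eval_mul_conj hh]

theorem MemHardy.fourierCoeff_taylorPoly_sq (hk : MemHardy 2 k) {N m : ℕ} (hm : m < N) :
    fourierCoeff (fun θ : Torus => (taylorPoly k N).eval (toCircle θ : ℂ) ^ 2) (m : ℤ) =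
      fourierCoeff (fun θ => k θ ^ 2) (m : ℤ) := by
  have h1 := memHardy_eval (taylorPoly k N) 2
  simp only [sq]
  rw [h1.fourierCoeff_mul h1, hk.fourierCoeff_mul hk]
  refine Finset.sum_congr rfl fun i hi => ?_
  have : i < m + 1 := Finset.mem_range.1 hi
  rw [fourierCoeff_eval, fourierCoeff_eval, taylorPoly_coeff, taylorPoly_coeff,
    if_pos (by omega), if_pos (by omega)]

theorem MemHardyZero.norm_derivForm_sq_le (hk : MemHardyZero 2 k) (f g : ℂ[X]) :
    ‖derivForm (fun θ => k θ ^ 2) f g‖ ≤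
      2 * ‖ofPoly g‖ * (twoNorm volume k *
        ((twoNorm volume fun θ : Torus => (ofPoly f).trace θ * k θ) +
          twoNorm logMeasure fun z : Disc => (ofPoly f).incl z * deriv (hardyExt k) (z : ℂ))) := by
  set P := taylorPoly k
  set ε : ℕ → ℝ := fun N => twoNorm volume fun θ => k θ - (P N).eval (toCircle θ : ℂ)
  have hε : Tendsto ε atTop (𝓝 0) :=
    (ENNReal.tendsto_toReal ENNReal.zero_ne_top).comp hk.1.tendsto_taylorPoly
  have hsub := fun N => (hk.1.sub_taylorPoly N).1
  have hkm := hk.1.1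
  have hftr : Continuous (ofPoly f).trace := (ofPoly f).continuous_trace
  have hfc : Continuous (ofPoly f).incl := (ofPoly f).incl.continuous
  have hfk : MemLp (fun θ => (ofPoly f).trace θ * k θ) 2 volume :=
    hkm.mul (memLp_of_continuous hftr ∞ _)
  have hkd := hk.memLp_deriv
  have hfkd : MemLp (fun z : Disc => (ofPoly f).incl z * deriv (hardyExt k) (z : ℂ)) 2 logMeasure :=
    hkd.mul (memLp_disc hfc ∞ _)
  have hdsub : ∀ N, MemLp (fun z : Disc => deriv (hardyExt k) (z : ℂ) -
      (derivative (P N)).eval (z : ℂ)) 2 logMeasure := fun N =>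
    hkd.sub (memLp_disc (continuous_eval_disc _) _ _)
  have hT : ∀ N, (twoNorm volume fun θ : Torus => (P N).eval (toCircle θ : ℂ)) ≤
      twoNorm volume k + 1 * ε N := fun N => by
    have h1 := twoNorm_add_le hkm (hsub N).neg
    have h2 := twoNorm_le_mul (F := -fun θ => k θ - (P N).eval (toCircle θ : ℂ)) (hsub N)
      zero_le_one (ae_of_all _ fun θ => by rw [Pi.neg_apply, norm_neg, one_mul])
    simp only [Pi.neg_apply, neg_sub, add_sub_cancel] at h1
    exact h1.trans (by gcongr)
  have hU : ∀ N, (twoNorm volume fun θ : Torus => f.eval (toCircle θ : ℂ) * (P N).eval (toCircle θ : ℂ))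
      ≤ (twoNorm volume fun θ => (ofPoly f).trace θ * k θ) + ‖ofPoly f‖ * ε N := fun N => by
    have h0 : MemLp (fun θ => -((ofPoly f).trace θ * (k θ - (P N).eval (toCircle θ : ℂ)))) 2 volume :=
      ((hsub N).mul (memLp_of_continuous hftr ∞ _)).neg
    have h1 := twoNorm_add_le hfk h0
    have h2 := twoNorm_le_mul (F := fun θ => -((ofPoly f).trace θ *
      (k θ - (P N).eval (toCircle θ : ℂ)))) (hsub N) (norm_nonneg (ofPoly f))
      (ae_of_all _ fun θ => by
        rw [norm_neg, norm_mul]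
        exact mul_le_mul_of_nonneg_right ((ofPoly f).norm_trace_le θ) (norm_nonneg _))
    have h3 : (fun θ => (ofPoly f).trace θ * k θ +
        -((ofPoly f).trace θ * (k θ - (P N).eval (toCircle θ : ℂ)))) =
        fun θ : Torus => f.eval (toCircle θ : ℂ) * (P N).eval (toCircle θ : ℂ) := by
      funext θ
      rw [ofPoly_trace]
      ring
    rw [h3] at h1
    exact h1.trans (by gcongr)
  have hV : ∀ N, (twoNorm logMeasure fun z : Disc => f.eval (z : ℂ) * (derivative (P N)).eval (z : ℂ))
      ≤ (twoNorm logMeasure fun z : Disc => (ofPoly f).incl z * deriv (hardyExt k) (z : ℂ)) +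
        ‖ofPoly f‖ * ε N := fun N => by
    have h0 : MemLp (fun z : Disc => -((ofPoly f).incl z * (deriv (hardyExt k) (z : ℂ) -
        (derivative (P N)).eval (z : ℂ)))) 2 logMeasure :=
      ((hdsub N).mul (memLp_disc hfc ∞ _)).neg
    have h1 := twoNorm_add_le hfkd h0
    have h2 := twoNorm_le_mul (F := fun z : Disc => -((ofPoly f).incl z *
      (deriv (hardyExt k) (z : ℂ) - (derivative (P N)).eval (z : ℂ)))) (hdsub N)
      (norm_nonneg (ofPoly f)) (ae_of_all _ fun z => by
        rw [norm_neg, norm_mul]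
        exact mul_le_mul_of_nonneg_right ((ofPoly f).norm_apply_le z) (norm_nonneg _))
    have h3 : (fun z : Disc => (ofPoly f).incl z * deriv (hardyExt k) (z : ℂ) +
        -((ofPoly f).incl z * (deriv (hardyExt k) (z : ℂ) - (derivative (P N)).eval (z : ℂ)))) =
        fun z : Disc => f.eval (z : ℂ) * (derivative (P N)).eval (z : ℂ) := by
      funext z
      rw [ofPoly_apply]
      ring
    have h4 : (twoNorm logMeasure fun z : Disc => deriv (hardyExt k) (z : ℂ) -
        (derivative (P N)).eval (z : ℂ)) ≤ ε N :=
      ENNReal.toReal_mono (hsub N).2.ne (hk.eLpNorm_deriv_sub_le N)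
    rw [h3] at h1
    exact h1.trans (by gcongr; exact h2.trans (by gcongr))
  have hlim : Tendsto (fun N => 2 * ‖ofPoly g‖ * ((twoNorm volume k + 1 * ε N) *
      (((twoNorm volume fun θ => (ofPoly f).trace θ * k θ) + ‖ofPoly f‖ * ε N) +
      ((twoNorm logMeasure fun z : Disc => (ofPoly f).incl z * deriv (hardyExt k) (z : ℂ)) +
        ‖ofPoly f‖ * ε N)))) atTop (𝓝 (2 * ‖ofPoly g‖ * ((twoNorm volume k + 1 * 0) *
      (((twoNorm volume fun θ => (ofPoly f).trace θ * k θ) + ‖ofPoly f‖ * 0) +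
      ((twoNorm logMeasure fun z : Disc => (ofPoly f).incl z * deriv (hardyExt k) (z : ℂ)) +
        ‖ofPoly f‖ * 0))))) :=
    (((hε.const_mul _).const_add _).mul (((hε.const_mul _).const_add _).add
      ((hε.const_mul _).const_add _))).const_mul _
  simp only [mul_zero, add_zero] at hlim
  refine ge_of_tendsto hlim ?_
  -- The form sees only the coefficients of the symbol up to the degree of `u`, and those of `k²`
  -- and of the squared Taylor polynomial agree below `N`. The left side is therefore eventually
  -- unchanged, and only the right side needs a limit.
  filter_upwards [eventually_gt_atTop (primitive (derivative f * g)).natDegree] with N hN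
  have heq : derivForm (fun θ => k θ ^ 2) f g =
      derivForm (fun θ => (P N).eval (toCircle θ : ℂ) ^ 2) f g := by
    have h1 : Integrable (fun θ => k θ ^ 2) haarAddCircle := by
      simpa only [sq] using (hk.1.mul hk.1).integrable_haar
    have h2 : Integrable (fun θ : Torus => (P N).eval (toCircle θ : ℂ) ^ 2) haarAddCircle :=
      integrable_of_continuous ((continuous_eval_toCircle _).pow 2)
    rw [derivForm_eq_sum h1, derivForm_eq_sum h2, Polynomial.sum, Polynomial.sum]
    congr 1
    refine Finset.sum_congr rfl fun m hm => ?_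
    rw [hk.1.fourierCoeff_taylorPoly_sq ((le_natDegree_of_mem_supp m hm).trans_lt hN)]
  rw [heq]
  refine (norm_derivForm_sq_eval_le f g (P N) (hk.eval_taylorPoly_zero N)).trans ?_
  refine mul_le_mul_of_nonneg_left (mul_le_mul (hT N) (add_le_add (hU N) (hV N))
    (add_nonneg twoNorm_nonneg twoNorm_nonneg) ?_) (by positivity)
  exact twoNorm_nonneg.trans (hT N)

/-! ### The control measures -/

theorem integral_withDensity_ofReal_sq {α : Type*} [MeasurableSpace α] {μ : Measure α} {k : α → ℂ}
    (hk : AEStronglyMeasurable k μ) (F : α → ℂ) :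
    ∫ x, ‖F x‖ ^ 2 ∂μ.withDensity (fun x => ENNReal.ofReal (‖k x‖ ^ 2)) =
      ∫ x, ‖F x * k x‖ ^ 2 ∂μ := by
  rw [integral_withDensity_eq_integral_toReal_smul₀ (hk.norm.aemeasurable.pow_const 2).ennreal_ofReal
    (ae_of_all _ fun _ => ENNReal.ofReal_lt_top)]
  refine integral_congr_ae (ae_of_all _ fun x => ?_)
  simp only [ENNReal.toReal_ofReal (sq_nonneg ‖k x‖), smul_eq_mul, norm_mul, mul_pow, mul_comm]

theorem isFiniteMeasure_withDensity_sq {α : Type*} [MeasurableSpace α] {μ : Measure α} {k : α → ℂ}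
    (hk : MemLp k 2 μ) : IsFiniteMeasure (μ.withDensity fun x => ENNReal.ofReal (‖k x‖ ^ 2)) :=
  isFiniteMeasure_withDensity_ofReal ((memLp_two_iff_integrable_sq_norm hk.1).1 hk).2

theorem isFiniteMeasure_scale_smul (k : Torus → ℂ) (μ : Measure Disc) [IsFiniteMeasure μ] :
    IsFiniteMeasure (scale k • μ) :=
  Measure.smul_finite μ ENNReal.ofReal_ne_top

theorem isFiniteMeasure_scale_boundaryMeasure (hk : MemHardyZero 2 k) :
    IsFiniteMeasure (scale k • boundaryMeasure k) := by
  have := isFiniteMeasure_withDensity_sq hk.1.1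
  have : IsFiniteMeasure (boundaryMeasure k) := Measure.isFiniteMeasure_map _ _
  exact isFiniteMeasure_scale_smul _ _

theorem isFiniteMeasure_scale_interiorMeasure (hk : MemHardyZero 2 k) :
    IsFiniteMeasure (scale k • interiorMeasure k) := by
  have : IsFiniteMeasure (interiorMeasure k) := isFiniteMeasure_withDensity_sq hk.memLp_deriv
  exact isFiniteMeasure_scale_smul _ _

theorem isFiniteMeasure_arcMeasure : IsFiniteMeasure arcMeasure :=
  Measure.isFiniteMeasure_map _ _

theorem l2Norm_scale_smul (hk : MemLp k 2 volume) (μ : Measure Disc) (f : DiscAlg) :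
    l2Norm (scale k • μ) f = 4 * twoNorm volume k * l2Norm μ f := by
  have h0 : 0 ≤ ∫ θ, ‖k θ‖ ^ 2 := integral_nonneg fun _ => by positivity
  rw [l2Norm, l2Norm, integral_smul_measure, scale, ENNReal.toReal_ofReal (by positivity),
    smul_eq_mul, Real.sqrt_mul (by positivity), Real.sqrt_mul (by norm_num), twoNorm_eq_sqrt hk,
    show (16 : ℝ) = 4 ^ 2 by norm_num, Real.sqrt_sq (by norm_num)]

theorem l2Norm_boundaryMeasure (hk : MemLp k 2 volume) (f : DiscAlg) :
    l2Norm (boundaryMeasure k) f = twoNorm volume fun θ => f.trace θ * k θ := by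
  have hc : Continuous f.incl := f.incl.continuous
  rw [l2Norm, boundaryMeasure, integral_map continuous_boundaryPoint.aemeasurable
    (by fun_prop : Continuous fun z => ‖f.incl z‖ ^ 2).aestronglyMeasurable,
    twoNorm_eq_sqrt (F := fun θ => f.trace θ * k θ)
      (hk.mul (memLp_of_continuous f.continuous_trace ∞ _))]
  congr 1
  exact integral_withDensity_ofReal_sq hk.1 f.trace

theorem l2Norm_interiorMeasure (hk : MemHardyZero 2 k) (f : DiscAlg) :
    l2Norm (interiorMeasure k) f =
      twoNorm logMeasure fun z : Disc => f.incl z * deriv (hardyExt k) (z : ℂ) := by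
  have hc : Continuous f.incl := f.incl.continuous
  rw [l2Norm, interiorMeasure, twoNorm_eq_sqrt
    (F := fun z : Disc => f.incl z * deriv (hardyExt k) (z : ℂ)) (hk.memLp_deriv.mul (memLp_disc hc ∞ _))]
  congr 1
  exact integral_withDensity_ofReal_sq hk.memLp_deriv.1 f.incl

theorem l2Norm_nonneg (μ : Measure Disc) (f : DiscAlg) : 0 ≤ l2Norm μ f := Real.sqrt_nonneg _

/-- The scaling contributes `4 ‖k‖₂` where the estimate needs `2 ‖k‖₂`. The half is kept for
`norm_derivForm_le_pietsch`. -/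
theorem MemHardyZero.norm_derivForm_sq_le_half (hk : MemHardyZero 2 k) (f g : ℂ[X]) :
    ‖derivForm (fun θ => k θ ^ 2) f g‖ ≤
      (l2Norm (scale k • boundaryMeasure k) (ofPoly f) +
        l2Norm (scale k • interiorMeasure k) (ofPoly f)) / 2 * ‖ofPoly g‖ := by
  refine (hk.norm_derivForm_sq_le f g).trans_eq ?_
  rw [l2Norm_scale_smul hk.1.1, l2Norm_scale_smul hk.1.1, l2Norm_boundaryMeasure hk.1.1,
    l2Norm_interiorMeasure hk]
  ring

theorem continuous_mul_toCircle (α : ℂ) : Continuous fun θ : Torus => α * (toCircle θ : ℂ) :=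
  (continuous_eval_toCircle (C α * X)).congr fun θ => by rw [eval_mul, eval_C, eval_X]

/-- Only the coefficient of `z` in `u` is seen, and it equals `f̂(1) ĝ(0)`. Bessel bounds the first
factor by the `L²` norm of `f`, evaluation at 0 bounds the second by `‖g‖`. -/
theorem norm_derivForm_linear_le (α : ℂ) (f g : ℂ[X]) :
    ‖derivForm (fun θ => α * (toCircle θ : ℂ)) f g‖ ≤
      l2Norm (ENNReal.ofReal (2 * π * ‖α‖ ^ 2) • arcMeasure) (ofPoly f) * ‖ofPoly g‖ := by
  have hc : Continuous (ofPoly f).incl := (ofPoly f).incl.continuous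
  have h1 : ∀ m : ℕ, fourierCoeff (fun θ : Torus => α * (toCircle θ : ℂ)) (m : ℤ) =
      if m = 1 then α else 0 := fun m => by
    simp only [← fourier_one]
    rw [fourierCoeff.const_mul, fourierCoeff_fourier, Pi.single_apply]
    by_cases hm : m = 1 <;> simp [hm]
  have h2 : derivForm (fun θ => α * (toCircle θ : ℂ)) f g =
      2 * π * (f.coeff 1 * g.coeff 0 * conj α) := by
    have hu : (primitive (derivative f * g)).coeff 1 = f.coeff 1 * g.coeff 0 := by
      have := congrArg (fun p : ℂ[X] => p.coeff 0) (derivative_primitive (derivative f * g))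
      simpa [coeff_derivative, mul_coeff_zero] using this
    rw [derivForm_eq_sum (integrable_of_continuous (continuous_mul_toCircle α)), ← hu]
    simp only [h1, apply_ite conj, map_zero, mul_ite, mul_zero]
    rw [Polynomial.sum, Finset.sum_ite_eq']
    split_ifs with h
    · rfl
    · rw [notMem_support_iff.1 h]
      simp
  have h3 : ‖g.coeff 0‖ ≤ ‖ofPoly g‖ := by
    have := (ofPoly g).norm_apply_le ⟨0, by simp⟩
    rwa [ofPoly_apply, ← coeff_zero_eq_eval_zero] at this
  have h4 : 2 * π * ‖f.coeff 1‖ ^ 2 ≤ ∫ θ, ‖(ofPoly f).trace θ‖ ^ 2 := by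
    have := le_hasSum (memHardy_trace (ofPoly f) 2).hasSum_sq 1 fun _ _ => by positivity
    rw [show (ofPoly f).trace = _ from funext (ofPoly_trace f), fourierCoeff_eval] at this
    rw [integral_eq_haar_real, show (ofPoly f).trace = _ from funext (ofPoly_trace f)]
    exact mul_le_mul_of_nonneg_left this Real.two_pi_pos.le
  have h5 : l2Norm (ENNReal.ofReal (2 * π * ‖α‖ ^ 2) • arcMeasure) (ofPoly f) =
      √(2 * π * ‖α‖ ^ 2 * ∫ θ, ‖(ofPoly f).trace θ‖ ^ 2) := by
    rw [l2Norm, integral_smul_measure, ENNReal.toReal_ofReal (by positivity), arcMeasure,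
      integral_map continuous_boundaryPoint.aemeasurable
      (by fun_prop : Continuous fun z => ‖(ofPoly f).incl z‖ ^ 2).aestronglyMeasurable]
    rfl
  have h6 : 2 * π * (‖f.coeff 1‖ * ‖α‖) ≤
      l2Norm (ENNReal.ofReal (2 * π * ‖α‖ ^ 2) • arcMeasure) (ofPoly f) := by
    rw [h5]
    refine Real.le_sqrt_of_sq_le ?_
    calc (2 * π * (‖f.coeff 1‖ * ‖α‖)) ^ 2 = 2 * π * ‖α‖ ^ 2 * (2 * π * ‖f.coeff 1‖ ^ 2) := by ring
      _ ≤ _ := mul_le_mul_of_nonneg_left h4 (by positivity)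
  rw [h2]
  calc ‖(2 * π * (f.coeff 1 * g.coeff 0 * conj α) : ℂ)‖
      = 2 * π * (‖f.coeff 1‖ * ‖α‖) * ‖g.coeff 0‖ := by
        simp only [norm_mul, RCLike.norm_conj, Complex.norm_ofNat, Complex.norm_real,
          Real.norm_of_nonneg Real.pi_pos.le]
        ring
    _ ≤ _ := mul_le_mul h6 h3 (norm_nonneg _) (l2Norm_nonneg _ _)

theorem integrable_eval_mul_conj {h : Torus → ℂ} (hh : Integrable h volume) (p : ℂ[X]) :
    Integrable (fun θ : Torus => p.eval (toCircle θ : ℂ) * conj (h θ)) volume :=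
  (integrable_conj hh).bdd_mul (c := ‖ofPoly p‖) (continuous_eval_toCircle p).aestronglyMeasurable
    (ae_of_all _ fun θ => by rw [← ofPoly_trace]; exact (ofPoly p).norm_trace_le θ)

theorem derivForm_add {h h' : Torus → ℂ} (hh : Integrable h volume) (hh' : Integrable h' volume)
    (f g : ℂ[X]) : derivForm (fun θ => h θ + h' θ) f g = derivForm h f g + derivForm h' f g := by
  simp only [derivForm, map_add, mul_add]
  exact integral_add (integrable_eval_mul_conj hh _) (integrable_eval_mul_conj hh' _)

namespace IsDecomposition

variable {h : Torus → ℂ} {α : ℂ} {k₁ k₂ : Torus → ℂ}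

theorem isFiniteMeasure_pieces (H : IsDecomposition h α k₁ k₂) (j : Fin 5) :
    IsFiniteMeasure (pieces α k₁ k₂ j) := by
  have := isFiniteMeasure_arcMeasure
  fin_cases j
  · exact Measure.smul_finite arcMeasure ENNReal.ofReal_ne_top
  · exact isFiniteMeasure_scale_boundaryMeasure H.left
  · exact isFiniteMeasure_scale_interiorMeasure H.left
  · exact isFiniteMeasure_scale_boundaryMeasure H.right
  · exact isFiniteMeasure_scale_interiorMeasure H.right

theorem norm_derivForm_le (H : IsDecomposition h α k₁ k₂) (f g : ℂ[X]) :
    ‖derivForm h f g‖ ≤ (l2Norm (pieces α k₁ k₂ 0) (ofPoly f) +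
      (l2Norm (pieces α k₁ k₂ 1) (ofPoly f) + l2Norm (pieces α k₁ k₂ 2) (ofPoly f)) / 2 +
      (l2Norm (pieces α k₁ k₂ 3) (ofPoly f) + l2Norm (pieces α k₁ k₂ 4) (ofPoly f)) / 2) *
        ‖ofPoly g‖ := by
  have h1 : derivForm h f g = derivForm (fun θ => α * (toCircle θ : ℂ)) f g +
      derivForm (fun θ => k₁ θ ^ 2) f g + derivForm (fun θ => k₂ θ ^ 2) f g := by
    have hi0 : Integrable (fun θ : Torus => α * (toCircle θ : ℂ)) volume :=
      memLp_one_iff_integrable.1 (memLp_of_continuous (continuous_mul_toCircle α) _ _)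
    have hi : ∀ k, MemHardyZero 2 k → Integrable (fun θ => k θ ^ 2) volume := fun k hk => by
      simpa only [sq] using memLp_one_iff_integrable.1 (hk.1.mul hk.1).1
    have hi1 : Integrable (fun θ => α * (toCircle θ : ℂ) + k₁ θ ^ 2) volume := hi0.add (hi _ H.left)
    rw [← derivForm_add hi0 (hi _ H.left), ← derivForm_add hi1 (hi _ H.right)]
    refine integral_congr_ae ?_
    filter_upwards [H.eq] with θ hθ
    rw [hθ]
  rw [h1, add_mul, add_mul]
  exact (norm_add₃_le).trans (add_le_add_three (norm_derivForm_linear_le α f g)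
    (H.left.norm_derivForm_sq_le_half f g) (H.right.norm_derivForm_sq_le_half f g))

theorem isFiniteMeasure_pietschMeasure (H : IsDecomposition h α k₁ k₂) :
    IsFiniteMeasure (pietschMeasure α k₁ k₂) := by
  have := H.isFiniteMeasure_pieces
  have : IsFiniteMeasure (∑ j, pieces α k₁ k₂ j) := by
    rw [Fin.sum_univ_five]
    infer_instance
  exact Measure.smul_finite _ ENNReal.ofReal_ne_top

theorem l2Norm_pietschMeasure_sq (H : IsDecomposition h α k₁ k₂) (f : DiscAlg) :
    l2Norm (pietschMeasure α k₁ k₂) f ^ 2 = √5 * ∑ j, l2Norm (pieces α k₁ k₂ j) f ^ 2 := by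
  have hc : Continuous f.incl := f.incl.continuous
  have hsq : ∀ μ : Measure Disc, l2Norm μ f ^ 2 = ∫ z, ‖f.incl z‖ ^ 2 ∂μ := fun μ =>
    Real.sq_sqrt (integral_nonneg fun _ => by positivity)
  have := H.isFiniteMeasure_pieces
  simp only [hsq]
  rw [pietschMeasure, integral_smul_measure, ENNReal.toReal_ofReal (Real.sqrt_nonneg _),
    smul_eq_mul, integral_finsetSum_measure]
  exact fun j _ => (memLp_two_iff_integrable_sq_norm hc.aestronglyMeasurable).1 (memLp_disc hc 2 _)

theorem norm_derivForm_le_pietsch (H : IsDecomposition h α k₁ k₂) (f g : ℂ[X]) :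
    ‖derivForm h f g‖ ≤ l2Norm (pietschMeasure α k₁ k₂) (ofPoly f) * ‖ofPoly g‖ := by
  refine (H.norm_derivForm_le f g).trans (mul_le_mul_of_nonneg_right ?_ (norm_nonneg _))
  refine le_of_abs_le (abs_le_of_sq_le_sq ?_ (l2Norm_nonneg _ _))
  rw [H.l2Norm_pietschMeasure_sq, Fin.sum_univ_five]
  generalize l2Norm (pieces α k₁ k₂ 0) (ofPoly f) = a
  generalize l2Norm (pieces α k₁ k₂ 1) (ofPoly f) = b
  generalize l2Norm (pieces α k₁ k₂ 2) (ofPoly f) = c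
  generalize l2Norm (pieces α k₁ k₂ 3) (ofPoly f) = d
  generalize l2Norm (pieces α k₁ k₂ 4) (ofPoly f) = e
  have h5 : (2 : ℝ) ≤ √5 := Real.le_sqrt_of_sq_le (by norm_num)
  -- Cauchy–Schwarz with weights `1, 1/2, 1/2, 1/2, 1/2`, whose squares add up to 2, and `2 ≤ √5`.
  have h6 : (a + (b + c) / 2 + (d + e) / 2) ^ 2 ≤ 2 * (a ^ 2 + b ^ 2 + c ^ 2 + d ^ 2 + e ^ 2) := by
    nlinarith [sq_nonneg (a - (b + c + d + e) / 2), sq_nonneg (b - c), sq_nonneg (d - e),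
      sq_nonneg (b - d), sq_nonneg (b - e), sq_nonneg (c - d), sq_nonneg (c - e)]
  exact h6.trans (mul_le_mul_of_nonneg_right h5 (by positivity))

end IsDecomposition

/-! ### Pietsch domination and its consequences -/

/-- The canonical map from the disc algebra to `L²(μ)`. -/
noncomputable def toL2 (μ : Measure Disc) [IsFiniteMeasure μ] : DiscAlg →L[ℂ] Lp ℂ 2 μ :=
  (ContinuousMap.toLp 2 μ ℂ).comp
    ⟨DiscAlg.incl.toLinearMap, DiscAlg.isometry_incl.continuous⟩

theorem toL2_apply (μ : Measure Disc) [IsFiniteMeasure μ] (f : DiscAlg) :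
    toL2 μ f = (memLp_disc f.incl.continuous 2 μ).toLp _ := by
  refine Lp.ext ?_
  exact (ContinuousMap.coeFn_toLp μ f.incl).trans (MemLp.coeFn_toLp _).symm

theorem norm_toL2 (μ : Measure Disc) [IsFiniteMeasure μ] (f : DiscAlg) :
    ‖toL2 μ f‖ = l2Norm μ f := by
  rw [toL2_apply, Lp.norm_toLp]
  exact twoNorm_eq_sqrt (memLp_disc f.incl.continuous 2 μ)

theorem continuous_l2Norm (μ : Measure Disc) [IsFiniteMeasure μ] : Continuous (l2Norm μ) := by
  simpa only [norm_toL2] using (toL2 μ).continuous.norm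

variable {D : DiscAlg →L[ℂ] StrongDual ℂ DiscAlg} {μ : Measure Disc} [IsFiniteMeasure μ]

theorem norm_le_l2Norm_of_ofPoly
    (hD : ∀ f g : ℂ[X], ‖D (ofPoly f) (ofPoly g)‖ ≤ l2Norm μ (ofPoly f) * ‖ofPoly g‖)
    (f : DiscAlg) : ‖D f‖ ≤ l2Norm μ f := by
  refine denseRange_ofPoly.induction_on f
    (isClosed_le D.continuous.norm (continuous_l2Norm μ)) fun p => ?_
  refine ContinuousLinearMap.opNorm_le_bound _ (l2Norm_nonneg _ _) fun g => ?_
  exact denseRange_ofPoly.induction_on g (isClosed_le (D (ofPoly p)).continuous.norm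
    (continuous_const.mul continuous_norm)) fun q => hD p q

theorem factorsThroughL2_of_norm_le (hD : ∀ f, ‖D f‖ ≤ l2Norm μ f) : FactorsThroughL2 D μ := by
  -- The bound makes `D` a contraction in the `L²` norm on the image of the disc algebra. It extends
  -- to the closure `K`, and then to all of `L²` through the orthogonal projection, without increase
  -- of norm.
  set K : Submodule ℂ (Lp ℂ 2 μ) := (LinearMap.range (toL2 μ).toLinearMap).topologicalClosure
  have : CompleteSpace K := (Submodule.isClosed_topologicalClosure _).completeSpace_coe
  have hmem : ∀ f, toL2 μ f ∈ K := fun f => Submodule.le_topologicalClosure _ ⟨f, rfl⟩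
  set e : DiscAlg →ₗ[ℂ] K := (toL2 μ).toLinearMap.codRestrict K hmem
  have he : DenseRange e := by
    intro x
    rw [closure_subtype]
    have hx : (x : Lp ℂ 2 μ) ∈ closure (Set.range (toL2 μ)) := x.2
    convert hx
    ext y
    constructor
    · rintro ⟨_, ⟨f, rfl⟩, rfl⟩
      exact ⟨f, rfl⟩
    · rintro ⟨f, rfl⟩
      exact ⟨e f, ⟨f, rfl⟩, rfl⟩
  have hnorm : ∀ f, ‖D.toLinearMap f‖ ≤ 1 * ‖e f‖ := fun f => by
    rw [one_mul]
    exact (hD f).trans_eq (norm_toL2 μ f).symm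
  refine ⟨(D.toLinearMap.extendOfNorm e).comp K.orthogonalProjectionOnto, ?_, fun f =>
    ⟨memLp_disc f.incl.continuous 2 μ, ?_⟩⟩
  · refine (ContinuousLinearMap.opNorm_comp_le _ _).trans ?_
    exact mul_le_one₀ (LinearMap.opNorm_extendOfNorm_le he zero_le_one hnorm)
      (ContinuousLinearMap.opNorm_nonneg _) K.orthogonalProjectionOnto_norm_le
  · rw [← toL2_apply, ContinuousLinearMap.comp_apply,
      show K.orthogonalProjectionOnto (toL2 μ f) = e f from
        K.orthogonalProjectionOnto_mem_subspace_eq_self (e f), LinearMap.extendOfNorm_eq he ⟨1, hnorm⟩]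
    rfl

/-- Evaluation at a point of the closed disc. -/
noncomputable def evalAt (z : Disc) : StrongDual ℂ DiscAlg :=
  LinearMap.mkContinuous
    { toFun := fun f => f.incl z
      map_add' := fun f g => by rw [map_add]; rfl
      map_smul' := fun c f => by rw [map_smul]; rfl } 1
    fun f => by rw [one_mul]; exact f.norm_apply_le z

theorem norm_evalAt_le (z : Disc) : ‖evalAt z‖ ≤ 1 :=
  LinearMap.mkContinuous_norm_le _ zero_le_one _

/-- Point evaluations lie in the unit ball of the dual, so `∑ |x i (z)|² ≤ S²` for every `z`;
integration against `μ` gives the constant `√(μ univ)`. -/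
theorem isTwoSumming_of_norm_le (hD : ∀ f, ‖D f‖ ≤ l2Norm μ f) : IsTwoSumming D := by
  refine ⟨√(μ.real Set.univ), fun n x => ?_⟩
  set S := ⨆ φ : Metric.closedBall (0 : StrongDual ℂ DiscAlg) 1, √(∑ i, ‖φ.1 (x i)‖ ^ 2)
  -- Needed because the real supremum of an unbounded family is 0 by convention.
  have hbdd : BddAbove (Set.range fun φ : Metric.closedBall (0 : StrongDual ℂ DiscAlg) 1 =>
      √(∑ i, ‖φ.1 (x i)‖ ^ 2)) := by
    refine ⟨√(∑ i, ‖x i‖ ^ 2), ?_⟩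
    rintro _ ⟨φ, rfl⟩
    have hφ : ‖φ.1‖ ≤ 1 := mem_closedBall_zero_iff.1 φ.2
    refine Real.sqrt_le_sqrt (Finset.sum_le_sum fun i _ => ?_)
    have := φ.1.le_of_opNorm_le hφ (x i)
    rw [one_mul] at this
    gcongr
  have hS0 : 0 ≤ S := Real.iSup_nonneg fun _ => Real.sqrt_nonneg _
  have hS : ∀ z, ∑ i, ‖(x i).incl z‖ ^ 2 ≤ S ^ 2 := fun z => by
    have h1 : √(∑ i, ‖(x i).incl z‖ ^ 2) ≤ S :=
      le_ciSup hbdd ⟨evalAt z, mem_closedBall_zero_iff.2 (norm_evalAt_le z)⟩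
    exact (Real.sqrt_le_left hS0).1 h1
  have hint : ∀ i, Integrable (fun z => ‖(x i).incl z‖ ^ 2) μ := fun i =>
    (memLp_two_iff_integrable_sq_norm (x i).incl.continuous.aestronglyMeasurable).1
      (memLp_disc (x i).incl.continuous 2 _)
  rw [← Real.sqrt_sq hS0, ← Real.sqrt_mul measureReal_nonneg]
  refine Real.sqrt_le_sqrt ?_
  calc ∑ i, ‖D (x i)‖ ^ 2 ≤ ∑ i, ∫ z, ‖(x i).incl z‖ ^ 2 ∂μ := Finset.sum_le_sum fun i _ => by
        rw [← Real.sq_sqrt (integral_nonneg fun z => by positivity)]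
        exact pow_le_pow_left₀ (norm_nonneg _) (hD (x i)) 2
    _ = ∫ z, ∑ i, ‖(x i).incl z‖ ^ 2 ∂μ := (integral_finsetSum _ fun i _ => hint i).symm
    _ ≤ ∫ _, S ^ 2 ∂μ := integral_mono (integrable_finsetSum _ fun i _ => hint i)
        (integrable_const _) hS
    _ = μ.real Set.univ * S ^ 2 := by rw [integral_const, smul_eq_mul]

end DiscPietsch

/-! ### Assembly: symbols, decomposition, estimates and Pietsch domination -/

theorem mainTheorem3 :
    -- every bounded derivation from the disc algebra to its dual is of the form `D_h`
    (∀ D : DiscPietsch.DiscAlg →L[ℂ] StrongDual ℂ DiscPietsch.DiscAlg,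
      DiscPietsch.IsDerivation D →
        ∃ h : DiscPietsch.Torus → ℂ, DiscPietsch.MemHardyZero 1 h ∧ DiscPietsch.HasSymbol D h) ∧
    -- every `h` in `H¹_0` can be written `α z + k₁² + k₂²`
    (∀ h : DiscPietsch.Torus → ℂ, DiscPietsch.MemHardyZero 1 h →
      ∃ (α : ℂ) (k₁ k₂ : DiscPietsch.Torus → ℂ), DiscPietsch.IsDecomposition h α k₁ k₂) ∧
    -- the estimate of `D_{k²}` on polynomials by two explicit finite measures
    (∀ k : DiscPietsch.Torus → ℂ, DiscPietsch.MemHardyZero 2 k →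
      IsFiniteMeasure (DiscPietsch.scale k • DiscPietsch.boundaryMeasure k) ∧
      IsFiniteMeasure (DiscPietsch.scale k • DiscPietsch.interiorMeasure k) ∧
      ∀ f g : ℂ[X], ‖DiscPietsch.derivForm (fun θ => k θ ^ 2) f g‖ ≤
        (DiscPietsch.l2Norm (DiscPietsch.scale k • DiscPietsch.boundaryMeasure k)
            (DiscPietsch.ofPoly f) +
          DiscPietsch.l2Norm (DiscPietsch.scale k • DiscPietsch.interiorMeasure k)
            (DiscPietsch.ofPoly f)) * ‖DiscPietsch.ofPoly g‖) ∧
    -- the estimate of `D_h` on polynomials by five explicit finite measures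
    (∀ (h : DiscPietsch.Torus → ℂ) (α : ℂ) (k₁ k₂ : DiscPietsch.Torus → ℂ),
      DiscPietsch.MemHardyZero 1 h → DiscPietsch.IsDecomposition h α k₁ k₂ →
        (∀ j, IsFiniteMeasure (DiscPietsch.pieces α k₁ k₂ j)) ∧
        ∀ f g : ℂ[X], ‖DiscPietsch.derivForm h f g‖ ≤
          (∑ j, DiscPietsch.l2Norm (DiscPietsch.pieces α k₁ k₂ j) (DiscPietsch.ofPoly f)) *
            ‖DiscPietsch.ofPoly g‖) ∧
    -- the control measure of a derivation, and its consequences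
    (∀ (D : DiscPietsch.DiscAlg →L[ℂ] StrongDual ℂ DiscPietsch.DiscAlg)
      (h : DiscPietsch.Torus → ℂ) (α : ℂ) (k₁ k₂ : DiscPietsch.Torus → ℂ),
      DiscPietsch.IsDerivation D → DiscPietsch.MemHardyZero 1 h → DiscPietsch.HasSymbol D h →
      DiscPietsch.IsDecomposition h α k₁ k₂ →
        IsFiniteMeasure (DiscPietsch.pietschMeasure α k₁ k₂) ∧
        (∀ f : DiscPietsch.DiscAlg,
          ‖D f‖ ≤ DiscPietsch.l2Norm (DiscPietsch.pietschMeasure α k₁ k₂) f) ∧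
        DiscPietsch.IsTwoSumming D ∧
        DiscPietsch.FactorsThroughL2 D (DiscPietsch.pietschMeasure α k₁ k₂)) := by
  refine ⟨fun D hD => hD.exists_hasSymbol, fun h hh => hh.exists_isDecomposition, fun k hk =>
    ⟨DiscPietsch.isFiniteMeasure_scale_boundaryMeasure hk,
      DiscPietsch.isFiniteMeasure_scale_interiorMeasure hk, fun f g => ?_⟩,
    fun h α k₁ k₂ _ H => ⟨H.isFiniteMeasure_pieces, fun f g => ?_⟩,
    fun D h α k₁ k₂ _ _ hDh H => ?_⟩
  · refine (hk.norm_derivForm_sq_le_half f g).trans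
      (mul_le_mul_of_nonneg_right (half_le_self ?_) (norm_nonneg _))
    exact add_nonneg (DiscPietsch.l2Norm_nonneg _ _) (DiscPietsch.l2Norm_nonneg _ _)
  · refine (H.norm_derivForm_le f g).trans (mul_le_mul_of_nonneg_right ?_ (norm_nonneg _))
    rw [Fin.sum_univ_five]
    have := fun j => DiscPietsch.l2Norm_nonneg (DiscPietsch.pieces α k₁ k₂ j) (DiscPietsch.ofPoly f)
    linarith [this 1, this 2, this 3, this 4]
  · have := H.isFiniteMeasure_pietschMeasure
    have hD := DiscPietsch.norm_le_l2Norm_of_ofPoly (D := D)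
      (μ := DiscPietsch.pietschMeasure α k₁ k₂) fun f g => by
        rw [hDh f g]
        exact H.norm_derivForm_le_pietsch f g
    exact ⟨this, hD, DiscPietsch.isTwoSumming_of_norm_le hD,
      DiscPietsch.factorsThroughL2_of_norm_le hD⟩
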